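/- Let $\ell\ge 1$ and let $\mathcal H$ be the space of hyperplanes of $\mathbb R^\ell$ with the Borel $\sigma$-algebra of the Fell topology. For $B\subseteq\mathbb R^\ell$ put $[B]=\{H\in\mathcal H: H\cap B\ne\emptyset\}$. For $H\in\mathcal H$ with $0\notin H$ let $H^+$ and $H^-$ be the closed half-spaces bounded by $H$, with $0\in\operatorname{int}H^+$. For $A,B\subseteq\mathbb R^\ell$ let $[A|B]$ be the set of all $H\in\mathcal H$ with $0\notin H$ such that one of $A,B$ is contained in $\operatorname{int}H^+$ and the other one in $\operatorname{int}H^-$. A window is a compact convex polytope with non-empty interior. Let $\Lambda$ be a non-zero, translation invariant measure on $\mathcal H$ with $\Lambda([B])<\infty$ for all bounded $B$, such that there is no line to which all hyperplanes in the support of $\Lambda$ are parallel. For a window $W$ put $\Lambda^W=\Lambda([W])^{-1}\Lambda(\,\cdot\,\cap[W])$. The STIT process $(Y_t\wedge W)_{t\ge 0}$ in a window $W$ is constructed as follows. The cells are organized in a dyadic tree with root $W$. Let $(d_{u,m})$ and $(\tau_{u,m})$, where $u$ runs through the vertices of the tree and $m$ through $1,2,\dots$, be two independent families of independent random variables on a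 probability space, each $d_{u,m}$ with law $\Lambda^W$ and each $\tau_{u,m}$ exponentially distributed with parameter $\Lambda([W])$. Let $C^u$ be the cell at the vertex $u$ and let $z_u$ be the first index $m$ such that $d_{u,m}$ meets $C^u$ (almost surely it exists). The cell $C^u$ has lifetime $\sum_{m=1}^{z_u}\tau_{u,m}$, and at the end of its lifetime it is divided into the two cells $C^u\cap d_{u,z_u}^{+}$ and $C^u\cap d_{u,z_u}^{-}$, which are born at that time and sit at the two successors of $u$ in the tree. The root $W$ is born at time $0$. The cells of $Y_t\wedge W$ are the cells that are born at or before time $t$ and die after time $t$. Let $W'$ and $W$ be windows with $0\in W'\subset\operatorname{int}W$. Then $W'$ is encapsulated inside $W$ at time $t$ if the cell $C_t$ of $Y_t\wedge W$ that contains $0$ in its interior satisfies $W'\subseteq C_t\subset\operatorname{int}W$; the encapsulation time is $$S(W',W)=\inf\{t>0: W'\text{ is encapsulated inside }W\text{ at time }t\}\in[0,\infty],\qquad \inf\emptyset=\infty .$$ **Lemma.** Let $W',W$ be windows with $0\in W'\subset\operatorname{int}W$, let $f_1,\dots,f_q$ be the $(\ell-1)$-dimensional facets of $W$ (each listed once),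 and let $G'_1,\dots,G'_q\subseteq\mathcal H$ be pairwise disjoint measurable sets with $G'_a\subseteq[W'|f_a]$ and $\Lambda(G'_a)>0$ for all $a=1,\dots,q$. Then for every $t\ge 0$ $$\mathbb P\bigl(S(W',W)\le t\bigr)\;\ge\; e^{-t\Lambda([W'])}\prod_{a=1}^{q}\bigl(1-e^{-t\Lambda(G'_a)}\bigr)+\int_0^t\Lambda([W'])\,e^{-x\Lambda([W'])}\prod_{a=1}^{q}\bigl(1-e^{-x\Lambda(G'_a)}\bigr)\,dx .$$ -/

import Mathlib

open MeasureTheory ProbabilityTheory Set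

noncomputable section

namespace STIT

/-- The Euclidean space of dimension `n`. -/
abbrev E (n : ℕ) : Type := EuclideanSpace ℝ (Fin n)

/-- The space of (affine) hyperplanes of `E n`. -/
def Hyperplane (n : ℕ) : Type :=
  {H : AffineSubspace ℝ (E n) //
    (H : Set (E n)).Nonempty ∧ Module.finrank ℝ H.direction + 1 = n}

namespace Hyperplane

variable {n : ℕ}

/-- The set of points of a hyperplane. -/
def pts (H : Hyperplane n) : Set (E n) := (H.1 : Set (E n))

/-- The translate `H + v` of a hyperplane. -/
def translate (v : E n) (H : Hyperplane n) : Hyperplane n :=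
  ⟨H.1.map (AffineEquiv.constVAdd ℝ (E n) v).toAffineMap, by
    refine ⟨?_, ?_⟩
    · rw [AffineSubspace.coe_map]
      exact H.2.1.image _
    · rw [AffineSubspace.map_direction]
      have h : (AffineEquiv.constVAdd ℝ (E n) v).toAffineMap.linear = LinearMap.id := rfl
      rw [h, Submodule.map_id]
      exact H.2.2⟩

/-- For a hyperplane `H` with `0 ∉ H`: the closed half-space `H⁺` bounded by `H` that contains `0`
in its interior if `b = true`, and the other closed half-space `H⁻` if `b = false`. -/
def halfSpace (b : Bool) (H : Hyperplane n) : Set (E n) :=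
  match b with
  | true => {x | H.1.WSameSide 0 x}
  | false => {x | H.1.WOppSide 0 x}

end Hyperplane

/-- `[B]`, the set of all hyperplanes that meet `B`. -/
def hitting {n : ℕ} (B : Set (E n)) : Set (Hyperplane n) := {H | (H.pts ∩ B).Nonempty}

/-- The Borel `σ`-algebra of the Fell topology on the space of hyperplanes: it is generated by the
sets `[K]`, `K` compact. -/
instance {n : ℕ} : MeasurableSpace (Hyperplane n) :=
  MeasurableSpace.generateFrom {A | ∃ K : Set (E n), IsCompact K ∧ A = hitting K}

/-- `[A|B]`, the set of all hyperplanes (not through the origin) that separate `A` and `B`. -/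
def separating {n : ℕ} (A B : Set (E n)) : Set (Hyperplane n) :=
  {H | (0 : E n) ∉ H.pts ∧
    ((A ⊆ interior (H.halfSpace true) ∧ B ⊆ interior (H.halfSpace false)) ∨
      (A ⊆ interior (H.halfSpace false) ∧ B ⊆ interior (H.halfSpace true)))}

/-- A window: a compact convex polytope (a bounded finite intersection of closed half-spaces)
with non-empty interior. -/
structure IsWindow {n : ℕ} (W : Set (E n)) : Prop where
  isCompact : IsCompact W
  interior_nonempty : (interior W).Nonempty
  polyhedral : ∃ s : Finset (E n × ℝ), W = {x | ∀ p ∈ s, inner ℝ p.1 x ≤ p.2}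

/-- The facets of `W`: its `(n - 1)`-dimensional exposed faces. -/
def facets {n : ℕ} (W : Set (E n)) : Set (Set (E n)) :=
  {F | IsExposed ℝ W F ∧ F.Nonempty ∧ Module.finrank ℝ (vectorSpan ℝ F) + 1 = n}

/-- The standing assumptions on the measure `Λ` on the space of hyperplanes: it is non-zero,
translation invariant, locally finite, and there is no line to which (almost) all hyperplanes are
parallel.  Being parallel to a given line is a closed condition on a hyperplane, so that
it holds on the whole support of `Λ` if and only if it holds `Λ`-almost everywhere. -/
structure IsDirecting {n : ℕ} (Λ : Measure (Hyperplane n)) : Prop where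
  ne_zero : Λ ≠ 0
  translation_invariant : ∀ v : E n, MeasurePreserving (Hyperplane.translate v) Λ Λ
  locally_finite : ∀ B : Set (E n), Bornology.IsBounded B → Λ (hitting B) < ⊤
  not_parallel : ¬ ∃ v : E n, v ≠ 0 ∧ ∀ᵐ H ∂Λ, v ∈ H.1.direction

/-- The normalized restriction `Λ^W = Λ([W])⁻¹ Λ_{[W]}` of `Λ` to `[W]`. -/
def normalized {n : ℕ} (Λ : Measure (Hyperplane n)) (W : Set (E n)) : Measure (Hyperplane n) :=
  (Λ (hitting W))⁻¹ • Λ.restrict (hitting W)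

/-- The random input of the construction of the STIT process in the window `W`: two independent
families of independent random variables `d u m` with law `Λ^W` and `τ u m` exponentially
distributed with parameter `Λ([W])`.  The first index `u` is the name of a cell, that is its
address in the dyadic tree of cells, so that distinct cells use distinct sequences. -/
structure IsInput {n : ℕ} (Λ : Measure (Hyperplane n)) (W : Set (E n))
    {Ω : Type*} [MeasurableSpace Ω] (P : Measure Ω)
    (d : List Bool → ℕ → Ω → Hyperplane n) (τ : List Bool → ℕ → Ω → ℝ) : Prop where
  measurable_d : ∀ u m, Measurable (d u m)
  measurable_τ : ∀ u m, Measurable (τ u m)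
  law_d : ∀ u m, P.map (d u m) = normalized Λ W
  law_τ : ∀ u m, P.map (τ u m) = expMeasure (Λ.real (hitting W))
  indep_d : iIndepFun (fun (i : List Bool × ℕ) ω => d i.1 i.2 ω) P
  indep_τ : iIndepFun (fun (i : List Bool × ℕ) ω => τ i.1 i.2 ω) P
  indep_d_τ : IndepFun (fun ω (i : List Bool × ℕ) => d i.1 i.2 ω)
    (fun ω (i : List Bool × ℕ) => τ i.1 i.2 ω) P

section Construction

/-! The construction of the process in the window `W` from one realization `h u m`, `s u m` of the
input.  The initial cell `W` has the empty address, and the two successors of the cell with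
address `u` have the addresses `true :: u` (on the side of the dividing hyperplane that contains
the origin) and `false :: u`. -/

variable {n : ℕ} (W : Set (E n)) (h : List Bool → ℕ → Hyperplane n) (s : List Bool → ℕ → ℝ)

/-- The first index `m` for which the `m`-th hyperplane of the sequence meets `C`; the hyperplanes
before it are rejected. (Almost surely such an index exists.) -/
def firstHit (C : Set (E n)) (H : ℕ → Hyperplane n) : ℕ := sInf {m | H m ∈ hitting C}

/-- The cell with address `u`. -/
def cell : List Bool → Set (E n)
  | [] => W
  | b :: u => cell u ∩ (h u (firstHit (cell u) (h u))).halfSpace b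

/-- The lifetime of the cell with address `u`: the sum of the waiting times up to and including
the one of the first hyperplane that is not rejected. -/
def lifetime (u : List Bool) : ℝ :=
  ∑ m ∈ Finset.range (firstHit (cell W h u) (h u) + 1), s u m

/-- The time of birth of the cell with address `u`: the sum of the lifetimes of its ancestors. -/
def birth : List Bool → ℝ
  | [] => 0
  | _ :: u => birth u + lifetime W h s u

/-- The set of cells of the tessellation `Y_t ∧ W`. -/
def cellsAt (t : ℝ) : Set (Set (E n)) :=
  {C | ∃ u, C = cell W h u ∧ birth W h s u ≤ t ∧ t < birth W h s u + lifetime W h s u}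

/-- `W'` is encapsulated inside `W` at time `t`: the cell of `Y_t ∧ W` that contains the origin in
its interior contains `W'` and is contained in the interior of `W`. -/
def EncapsulatedAt (W' : Set (E n)) (t : ℝ) : Prop :=
  ∃ C ∈ cellsAt W h s t, (0 : E n) ∈ interior C ∧ W' ⊆ C ∧ C ⊆ interior W

/-- The encapsulation time `S(W', W) = inf {t > 0 : W' |_t W}`, which is `⊤` if there is no such
`t`. -/
def encapsulationTime (W' : Set (E n)) : EReal :=
  sInf ((fun t : ℝ => (t : EReal)) '' {t : ℝ | 0 < t ∧ EncapsulatedAt W h s W' t})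

end Construction

end STIT

end

/-!
The proof follows the zero cell, that is the cell that contains the origin, and the marked
hyperplanes that it reads, whether they divide it or are rejected.

Geometry: as long as no hyperplane that hits `W'` has arrived, the zero cell contains `W'` and has
the origin in its interior (`IsZeroCell`).  A hyperplane from `G' a` separates the zero cell from
the facet `f a`: if it hits the cell, then the new zero cell lies on its positive side, and if it
misses the cell, then the cell already lay there.  The facets cover the boundary of `W`
(`exists_facet_mem`).  Hence `W'` is encapsulated once a hyperplane from every `G' a` has arrived and
before one that hits `W'` has (`exists_encapsulatedAt`).

Probability: although the zero cell changes to a fresh sequence of the input whenever it is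
divided, after every single step the unread part of the input is again a fresh copy of the whole
(`map_eval_prodMk_comp_infinitePi`, applied to the reindexings `rejectIdx` and `acceptIdx`).
Therefore the hyperplanes arrive as in a Poisson process of intensity `Λ` on `[W]`, and the
probability of having collected all `G' a` by time `t` and before a hyperplane that hits `W'`
solves a renewal equation in which the geometry of the cell does not occur.  The right side of the
claim, `collectBound`, solves the same equation (`collectBound_renewal`).  The integral operator
of this equation contracts by the factor `1 - exp (-t Λ([W]))`, so that the probability of success
within `N` steps is at least the bound up to the `N`-th power of this factor
(`collectBound_sub_le`).

Measurability: conditioning on the first step requires that the event that a random hyperplane hits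
a random cell be measurable.  The foot of a hyperplane, its point closest to the origin, is a
measurable function of the hyperplane (`measurable_foot`), and it determines both the half-space
`H⁺` and the event that `H` hits a cell containing the origin.
-/

noncomputable section

namespace STIT

/-! ### Independent families -/

/-- If the families `X` and `Y` each consist of independent variables and are independent of each
other, then the pairs `(X i, Y i)` are independent: by the `π`-`λ` theorem it is enough to look at
measurable rectangles. -/
lemma iIndepFun_prodMk {ι Ω α β : Type*} [MeasurableSpace Ω] [MeasurableSpace α]
    [MeasurableSpace β] {P : Measure Ω} {X : ι → Ω → α} {Y : ι → Ω → β}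
    (hX : ∀ i, Measurable (X i)) (hY : ∀ i, Measurable (Y i))
    (hXi : iIndepFun X P) (hYi : iIndepFun Y P)
    (hXY : IndepFun (fun ω i => X i ω) (fun ω i => Y i ω) P) :
    iIndepFun (fun i ω => (X i ω, Y i ω)) P := by
  rw [iIndepFun_iff_iIndep]
  refine iIndepSets.iIndep (fun i => ((hX i).prodMk (hY i)).comap_le)
    (fun i => preimage (fun ω => (X i ω, Y i ω)) ''
      image2 (· ×ˢ ·) {s : Set α | MeasurableSet s} {t : Set β | MeasurableSet t})
    (fun i => ?_) (fun i => ?_) ?_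
  · rintro _ ⟨_, ⟨a, ha, b, hb, rfl⟩, rfl⟩ _ ⟨_, ⟨c, hc, e, he, rfl⟩, rfl⟩ -
    refine ⟨_, ⟨a ∩ c, MeasurableSet.inter ha hc, b ∩ e, MeasurableSet.inter hb he, rfl⟩, ?_⟩
    beta_reduce
    rw [← prod_inter_prod, preimage_inter]
  · rw [← generateFrom_prod, MeasurableSpace.comap_generateFrom]
  · rw [iIndepSets_iff]
    intro s F hF
    choose! R hR hRF using hF
    choose! A hA B hB hAB using hR
    have hF' : ∀ i ∈ s, F i = X i ⁻¹' A i ∩ Y i ⁻¹' B i := by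
      intro i hi
      rw [← hRF i hi, ← hAB i hi]
      rfl
    have h1 : (⋂ i ∈ s, F i) = (fun ω i => X i ω) ⁻¹' (⋂ i ∈ s, {x | x i ∈ A i}) ∩
        (fun ω i => Y i ω) ⁻¹' (⋂ i ∈ s, {x | x i ∈ B i}) := by
      rw [iInter₂_congr hF']
      ext ω
      simp only [mem_iInter, mem_inter_iff, mem_preimage, mem_ofPred_eq]
      exact ⟨fun h => ⟨fun i hi => (h i hi).1, fun i hi => (h i hi).2⟩,
        fun h i hi => ⟨h.1 i hi, h.2 i hi⟩⟩
    have hmA : MeasurableSet (⋂ i ∈ s, {x : ι → α | x i ∈ A i}) :=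
      Finset.measurableSet_biInter s fun i hi => (measurable_pi_apply i) (hA i hi)
    have hmB : MeasurableSet (⋂ i ∈ s, {x : ι → β | x i ∈ B i}) :=
      Finset.measurableSet_biInter s fun i hi => (measurable_pi_apply i) (hB i hi)
    rw [h1, hXY.measure_inter_preimage_eq_mul _ _ hmA hmB]
    have h2 : (fun ω i => X i ω) ⁻¹' (⋂ i ∈ s, {x | x i ∈ A i}) = ⋂ i ∈ s, X i ⁻¹' A i := by
      ext ω; simp
    have h3 : (fun ω i => Y i ω) ⁻¹' (⋂ i ∈ s, {x | x i ∈ B i}) = ⋂ i ∈ s, Y i ⁻¹' B i := by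
      ext ω; simp
    rw [h2, h3, hXi.measure_inter_preimage_eq_mul s hA, hYi.measure_inter_preimage_eq_mul s hB,
      ← Finset.prod_mul_distrib]
    refine Finset.prod_congr rfl fun i hi => ?_
    rw [hF' i hi]
    refine ((hXY.comp (measurable_pi_apply i) (measurable_pi_apply i)
      ).measure_inter_preimage_eq_mul _ _ (hA i hi) (hB i hi)).symm

/-- Under an infinite power of a probability measure, one coordinate together with a reindexed
family that avoids this coordinate is distributed as a fresh copy of the coordinate and a fresh
copy of the family. -/
lemma map_eval_prodMk_comp_infinitePi {ι κ α : Type*} [MeasurableSpace α] (ν : Measure α)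
    [IsProbabilityMeasure ν] (i₀ : ι) {e : κ → ι} (he : Function.Injective e)
    (hi : ∀ k, e k ≠ i₀) :
    (Measure.infinitePi fun _ : ι => ν).map (fun y => (y i₀, fun k => y (e k))) =
      ν.prod (Measure.infinitePi fun _ : κ => ν) := by
  have hind : IndepFun (fun y : ι → α => y i₀) (fun y k => y (e k))
      (Measure.infinitePi fun _ : ι => ν) := by
    have h := iIndepFun_infinitePi (P := fun _ : ι => ν) (X := fun _ x => x)
      (fun _ => measurable_id)
    rw [iIndepFun_iff_iIndep] at h
    have h2 := indep_iSup_of_disjoint (fun i => (measurable_pi_apply i).comap_le) h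
      (S := {i₀}) (T := range e) (by
        rw [disjoint_singleton_left]; rintro ⟨k, hk⟩; exact hi k hk)
    rw [IndepFun_iff_Indep]
    refine indep_of_indep_of_le_left (indep_of_indep_of_le_right h2 ?_) ?_
    · rw [MeasurableSpace.pi, MeasurableSpace.comap_iSup]
      refine iSup_le fun k => ?_
      rw [MeasurableSpace.comap_comp]
      exact le_iSup₂_of_le (e k) (mem_range_self k) le_rfl
    · exact le_iSup₂_of_le i₀ (mem_singleton i₀) le_rfl
  rw [hind.map_prod_eq_prod_map_map (Measurable.aemeasurable (by fun_prop))
    (Measurable.aemeasurable (by fun_prop)), Measure.infinitePi_map_eval,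
    Measure.map_infinitePi_infinitePi_of_inj he]

variable {n : ℕ}

/-! ### Feet of hyperplanes -/

/-- Every hyperplane is a level set `⟪u, x⟫ = p` with a unit vector `u` and `p ≥ 0`. -/
lemma Hyperplane.exists_normal (H : Hyperplane n) :
    ∃ (u : E n) (p : ℝ), ‖u‖ = 1 ∧ 0 ≤ p ∧ H.pts = {x | inner ℝ u x = p} := by
  have hfin : Module.finrank ℝ (H.1.directionᗮ) = 1 := by
    have h1 := Submodule.finrank_add_finrank_orthogonal H.1.direction
    have h2 := H.2.2
    rw [finrank_euclideanSpace_fin] at h1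
    omega
  obtain ⟨⟨w, hw⟩, hw0, hspan⟩ := finrank_eq_one_iff'.1 hfin
  have hw0' : w ≠ 0 := fun h => hw0 (by simp [h])
  have hdir : ∀ v : E n, v ∈ H.1.direction ↔ inner ℝ w v = 0 := by
    intro v
    constructor
    · intro hv
      rw [real_inner_comm]
      exact (Submodule.mem_orthogonal _ _).1 hw v hv
    · intro hv
      rw [← Submodule.orthogonal_orthogonal H.1.direction, Submodule.mem_orthogonal]
      intro z hz
      obtain ⟨c, hc⟩ := hspan ⟨z, hz⟩
      have hc' : c • w = z := congrArg Subtype.val hc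
      rw [← hc', inner_smul_left, hv, mul_zero]
  obtain ⟨x₀, hx₀⟩ := H.2.1
  have key : ∀ u : E n, ∀ c : ℝ, c ≠ 0 → u = c • w →
      H.pts = {x | inner ℝ u x = inner ℝ u x₀} := by
    rintro u c hc rfl
    ext x
    have h1 : x ∈ H.pts ↔ x - x₀ ∈ H.1.direction :=
      (AffineSubspace.vsub_right_mem_direction_iff_mem (s := H.1) hx₀ x).symm
    rw [h1, hdir, mem_ofPred_eq, inner_sub_right, inner_smul_left, inner_smul_left]
    simp [hc, sub_eq_zero]
  have hnw : ‖w‖ ≠ 0 := norm_ne_zero_iff.2 hw0'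
  rcases le_total 0 (inner ℝ w x₀) with h | h
  · refine ⟨‖w‖⁻¹ • w, _, norm_smul_inv_norm hw0', ?_, key _ ‖w‖⁻¹ (inv_ne_zero hnw) rfl⟩
    rw [real_inner_smul_left]
    positivity
  · refine ⟨(-‖w‖⁻¹) • w, _, ?_, ?_, key _ (-‖w‖⁻¹) (neg_ne_zero.2 (inv_ne_zero hnw)) rfl⟩
    · rw [neg_smul, norm_neg]; exact norm_smul_inv_norm hw0'
    · rw [real_inner_smul_left, neg_mul, neg_nonneg]
      exact mul_nonpos_of_nonneg_of_nonpos (by positivity) h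

lemma infDist_levelSet {u : E n} (hu : ‖u‖ = 1) (p : ℝ) (x : E n) :
    Metric.infDist x {y | inner ℝ u y = p} = |inner ℝ u x - p| := by
  have huu : inner ℝ u u = (1 : ℝ) := by rw [real_inner_self_eq_norm_sq, hu]; norm_num
  have hmem : x - (inner ℝ u x - p) • u ∈ {y : E n | inner ℝ u y = p} := by
    rw [mem_ofPred_eq, inner_sub_right, real_inner_smul_right, huu]; ring
  apply le_antisymm
  · refine (Metric.infDist_le_dist_of_mem hmem).trans ?_
    rw [dist_eq_norm, sub_sub_cancel, norm_smul, hu, mul_one, Real.norm_eq_abs]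
  · refine (Metric.le_infDist ⟨_, hmem⟩).2 fun y hy => ?_
    rw [mem_ofPred_eq] at hy
    rw [dist_eq_norm, ← hy, ← inner_sub_right]
    simpa [hu] using abs_real_inner_le_norm u (x - y)

/-- The foot of a hyperplane: its point closest to the origin.  It is defined through the
distances of the hyperplane from the points `± eᵢ`, from which its measurability is read off. -/
def Hyperplane.foot (H : Hyperplane n) : E n :=
  WithLp.toLp 2 fun i => (Metric.infDist (-(EuclideanSpace.single i (1 : ℝ))) H.pts ^ 2 -
    Metric.infDist (EuclideanSpace.single i (1 : ℝ)) H.pts ^ 2) / 4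

lemma Hyperplane.exists_normal_foot (H : Hyperplane n) :
    ∃ (u : E n) (p : ℝ), ‖u‖ = 1 ∧ 0 ≤ p ∧ H.pts = {x | inner ℝ u x = p} ∧ H.foot = p • u := by
  obtain ⟨u, p, hu, hp, hH⟩ := H.exists_normal
  refine ⟨u, p, hu, hp, hH, ?_⟩
  ext i
  have h : (inner ℝ u (EuclideanSpace.single i (1 : ℝ)) : ℝ) = u i := by
    simp [EuclideanSpace.inner_single_right]
  simp only [Hyperplane.foot, hH, infDist_levelSet hu, sq_abs, inner_neg_right, h,
    PiLp.smul_apply, smul_eq_mul]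
  ring

lemma Hyperplane.infDist_le_iff (H : Hyperplane n) (x : E n) (r : ℝ) :
    Metric.infDist x H.pts ≤ r ↔ H ∈ hitting (Metric.closedBall x r) := by
  obtain ⟨u, p, hu, -, hH⟩ := H.exists_normal
  have hcl : IsClosed H.pts := by
    rw [hH]; exact isClosed_eq (by fun_prop) (by fun_prop)
  have hne : H.pts.Nonempty := H.2.1
  constructor
  · intro h
    obtain ⟨y, hy, hxy⟩ := hcl.exists_infDist_eq_dist hne x
    exact ⟨y, hy, by rw [Metric.mem_closedBall, dist_comm, ← hxy]; exact h⟩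
  · rintro ⟨y, hy, hxy⟩
    rw [Metric.mem_closedBall, dist_comm] at hxy
    exact (Metric.infDist_le_dist_of_mem hy).trans hxy

lemma measurableSet_hitting {K : Set (E n)} (hK : IsCompact K) : MeasurableSet (hitting K) :=
  MeasurableSpace.measurableSet_generateFrom ⟨K, hK, rfl⟩

lemma measurable_infDist_pts (x : E n) :
    Measurable fun H : Hyperplane n => Metric.infDist x H.pts := by
  refine measurable_of_Iic fun r => ?_
  have : (fun H : Hyperplane n => Metric.infDist x H.pts) ⁻¹' Iic r =
      hitting (Metric.closedBall x r) := by
    ext H; exact H.infDist_le_iff x r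
  rw [this]
  exact measurableSet_hitting (isCompact_closedBall x r)

lemma measurable_foot : Measurable (Hyperplane.foot : Hyperplane n → E n) := by
  refine (WithLp.measurable_toLp 2 _).comp (measurable_pi_lambda _ fun i => ?_)
  exact (((measurable_infDist_pts _).pow_const 2).sub
    ((measurable_infDist_pts _).pow_const 2)).div_const 4

/-- The half-space `H⁺` in terms of the foot.  If `0 ∈ H`, then the foot is `0` and both sides are
the whole space. -/
lemma Hyperplane.halfSpace_true (H : Hyperplane n) :
    H.halfSpace true = {x | inner ℝ H.foot x ≤ ‖H.foot‖ ^ 2} := by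
  obtain ⟨u, p, hu, hp, hH, hf⟩ := H.exists_normal_foot
  have huu : inner ℝ u u = (1 : ℝ) := by rw [real_inner_self_eq_norm_sq, hu]; norm_num
  have hmem : ∀ x, x ∈ H.1 ↔ inner ℝ u x = p := fun x => by
    change x ∈ H.pts ↔ _; rw [hH]; rfl
  ext x
  change H.1.WSameSide 0 x ↔ _
  rw [mem_ofPred_eq, hf, real_inner_smul_left, norm_smul, hu, mul_one, Real.norm_eq_abs, sq_abs]
  rcases hp.eq_or_lt with rfl | hp
  · simp [AffineSubspace.wSameSide_of_left_mem x ((hmem 0).2 (inner_zero_right u))]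
  · rw [sq, mul_le_mul_iff_right₀ hp]
    constructor
    · rintro ⟨a, ha, b, hb, hab⟩
      rw [hmem] at ha hb
      rcases hab with h | h | ⟨r₁, r₂, hr₁, hr₂, h⟩
      · have := congrArg (fun z => inner ℝ u z) h
        simp [ha] at this
        exact absurd this hp.ne'
      · have := congrArg (fun z => inner ℝ u z) h
        simp [hb, inner_sub_right, sub_eq_zero] at this
        exact this.le
      · have := congrArg (fun z => inner ℝ u z) h
        simp [hb, inner_sub_right, inner_smul_right, ha] at this
        by_contra! hlt
        have h1 : 0 < r₁ * p := mul_pos hr₁ hp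
        have h2 : 0 < r₂ * (inner ℝ u x - p) := mul_pos hr₂ (by linarith)
        linarith
    · intro h
      refine AffineSubspace.wSameSide_of_vsub_eq_smul (p₁ := p • u)
        (p₂ := x + (p - inner ℝ u x) • u) (m := -u) (c₁ := p) (c₂ := p - inner ℝ u x)
        ((hmem _).2 ?_) ((hmem _).2 ?_) ?_ ?_ (mul_nonneg hp.le (by linarith))
      · rw [real_inner_smul_right, huu, mul_one]
      · rw [inner_add_right, real_inner_smul_right, huu]; ring
      · rw [vsub_eq_sub, zero_sub, smul_neg]
      · rw [vsub_eq_sub, smul_neg]; abel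

lemma Hyperplane.halfSpace_false {H : Hyperplane n} (h0 : (0 : E n) ∉ H.pts) :
    H.halfSpace false = {x | ‖H.foot‖ ^ 2 ≤ inner ℝ H.foot x} := by
  obtain ⟨u, p, hu, hp, hH, hf⟩ := H.exists_normal_foot
  have huu : inner ℝ u u = (1 : ℝ) := by rw [real_inner_self_eq_norm_sq, hu]; norm_num
  have hmem : ∀ x, x ∈ H.1 ↔ inner ℝ u x = p := fun x => by
    change x ∈ H.pts ↔ _; rw [hH]; rfl
  ext x
  change H.1.WOppSide 0 x ↔ _
  rw [mem_ofPred_eq, hf, real_inner_smul_left, norm_smul, hu, mul_one, Real.norm_eq_abs, sq_abs]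
  rcases hp.eq_or_lt with rfl | hp
  · exact absurd ((hmem 0).2 (inner_zero_right u)) h0
  · rw [sq, mul_le_mul_iff_right₀ hp]
    constructor
    · rintro ⟨a, ha, b, hb, hab⟩
      rw [hmem] at ha hb
      rcases hab with h | h | ⟨r₁, r₂, hr₁, hr₂, h⟩
      · have := congrArg (fun z => inner ℝ u z) h
        simp [ha] at this
        exact absurd this hp.ne'
      · have := congrArg (fun z => inner ℝ u z) h
        simp [hb, inner_sub_right, sub_eq_zero] at this
        exact this.le
      · have := congrArg (fun z => inner ℝ u z) h
        simp [hb, inner_sub_right, inner_smul_right, ha] at this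
        by_contra! hlt
        have h1 : 0 < r₁ * p := mul_pos hr₁ hp
        have h2 : 0 < r₂ * (p - inner ℝ u x) := mul_pos hr₂ (by linarith)
        linarith
    · intro h
      refine AffineSubspace.wOppSide_of_vsub_eq_smul (p₁ := p • u)
        (p₂ := x + (p - inner ℝ u x) • u) (m := -u) (c₁ := p) (c₂ := p - inner ℝ u x)
        ((hmem _).2 ?_) ((hmem _).2 ?_) ?_ ?_ (mul_nonpos_of_nonneg_of_nonpos hp.le (by linarith))
      · rw [real_inner_smul_right, huu, mul_one]
      · rw [inner_add_right, real_inner_smul_right, huu]; ring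
      · rw [vsub_eq_sub, zero_sub, smul_neg]
      · rw [vsub_eq_sub, smul_neg]; abel

/-- For a set that contains the origin, being hit by `H` is a statement about the foot of `H`,
even if `0 ∈ H`. -/
lemma mem_hitting_iff_foot {C : Set (E n)} (h0 : (0 : E n) ∈ C) (H : Hyperplane n) :
    H ∈ hitting C ↔ ∃ x ∈ C, inner ℝ H.foot x = ‖H.foot‖ ^ 2 := by
  obtain ⟨u, p, hu, hp, hH, hf⟩ := H.exists_normal_foot
  have hmem : ∀ x, x ∈ H.pts ↔ inner ℝ u x = p := fun x => by rw [hH]; rfl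
  have hfx : ∀ x, inner ℝ H.foot x = p * inner ℝ u x := fun x => by
    rw [hf, real_inner_smul_left]
  have hfn : ‖H.foot‖ ^ 2 = p * p := by
    rw [hf, norm_smul, hu, mul_one, Real.norm_eq_abs, sq_abs, sq]
  simp only [hfx, hfn]
  rcases hp.eq_or_lt with rfl | hp
  · exact ⟨fun _ => ⟨0, h0, by simp⟩, fun _ => ⟨0, (hmem 0).2 (inner_zero_right u), h0⟩⟩
  · constructor
    · rintro ⟨x, hx, hxC⟩
      exact ⟨x, hxC, by rw [(hmem x).1 hx]⟩
    · rintro ⟨x, hxC, hx⟩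
      exact ⟨x, (hmem x).2 (mul_left_cancel₀ hp.ne' hx), hxC⟩

lemma Hyperplane.foot_ne_zero {H : Hyperplane n} (h0 : (0 : E n) ∉ H.pts) : H.foot ≠ 0 := by
  obtain ⟨u, p, hu, hp, hH, hf⟩ := H.exists_normal_foot
  rw [hf]
  have hu0 : u ≠ 0 := norm_ne_zero_iff.1 (by rw [hu]; exact one_ne_zero)
  refine smul_ne_zero (fun hp0 => h0 ?_) hu0
  rw [hH, mem_ofPred_eq, inner_zero_right, hp0]

/-- A star-shaped set that is not hit by `H` lies strictly on the side of the origin. -/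
lemma inner_foot_lt_of_notMem_hitting {C : Set (E n)} (h0 : (0 : E n) ∈ C)
    (hC : StarConvex ℝ 0 C) {H : Hyperplane n} (hH : H ∉ hitting C) {x : E n} (hx : x ∈ C) :
    inner ℝ H.foot x < ‖H.foot‖ ^ 2 := by
  rw [mem_hitting_iff_foot h0] at hH
  by_contra! hle
  apply hH
  have hf0 : H.foot ≠ 0 := fun h => hH ⟨0, h0, by simp [h]⟩
  have hpos : 0 < ‖H.foot‖ ^ 2 := by positivity
  have hxpos : 0 < inner ℝ H.foot x := hpos.trans_le hle
  refine ⟨(‖H.foot‖ ^ 2 / inner ℝ H.foot x) • x, ?_, ?_⟩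
  · exact hC.smul_mem hx (by positivity) ((div_le_one hxpos).2 hle)
  · rw [real_inner_smul_right]
    field_simp

/-- An interior point of a closed half-space satisfies the defining inequality strictly. -/
lemma inner_lt_of_mem_interior {v : E n} (hv : v ≠ 0) {A : Set (E n)} {c : ℝ}
    (hA : ∀ y ∈ A, inner ℝ v y ≤ c) {x : E n} (hx : x ∈ interior A) : inner ℝ v x < c := by
  have hcont : Filter.Tendsto (fun ε : ℝ => x + ε • v) (nhdsWithin 0 (Ioi 0)) (nhds x) := by
    have : Continuous fun ε : ℝ => x + ε • v := by fun_prop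
    simpa using (this.tendsto 0).mono_left nhdsWithin_le_nhds
  obtain ⟨ε, hε, hεpos⟩ := ((hcont.eventually (mem_interior_iff_mem_nhds.1 hx)).and
    self_mem_nhdsWithin).exists
  have h1 := hA _ hε
  rw [inner_add_right, real_inner_smul_right, real_inner_self_eq_norm_sq] at h1
  have h2 : 0 < ε * ‖v‖ ^ 2 := mul_pos hεpos (by positivity)
  linarith

/-- A hyperplane that separates `A ∋ 0` from `B` has `A` strictly on the side of the origin and
`B` strictly on the other side. -/
lemma inner_foot_of_mem_separating {A B : Set (E n)} (h0 : (0 : E n) ∈ A) {H : Hyperplane n}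
    (hH : H ∈ separating A B) :
    (∀ x ∈ A, inner ℝ H.foot x < ‖H.foot‖ ^ 2) ∧ ∀ x ∈ B, ‖H.foot‖ ^ 2 < inner ℝ H.foot x := by
  obtain ⟨hH0, h⟩ := hH
  have hf := Hyperplane.foot_ne_zero hH0
  rcases h with ⟨hA, hB⟩ | ⟨hA, -⟩
  · rw [H.halfSpace_true] at hA
    rw [Hyperplane.halfSpace_false hH0] at hB
    refine ⟨fun x hx => inner_lt_of_mem_interior hf (fun y hy => hy) (hA hx), fun x hx => ?_⟩
    have := inner_lt_of_mem_interior (v := -H.foot) (c := -‖H.foot‖ ^ 2) (neg_ne_zero.2 hf)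
      (fun y hy => by rw [inner_neg_left]; exact neg_le_neg hy) (hB hx)
    rw [inner_neg_left] at this
    linarith
  · have h1 : (0 : E n) ∈ H.halfSpace false := interior_subset (hA h0)
    exact absurd (AffineSubspace.wOppSide_self_iff.1 h1) hH0

/-! ### Facets of a polytope -/

/-- If the constraint `⟪v, x⟫ ≤ c` is active at a point `y ∈ W` and `W` contains all points of the
hyperplane `⟪v, x⟫ = c` near `y`, then the constraint defines a facet. -/
lemma mem_facets_of_eventually {W : Set (E n)} {v : E n} {c : ℝ} (hv : v ≠ 0)
    (hW : ∀ x ∈ W, inner ℝ v x ≤ c) {y : E n} (hyc : inner ℝ v y = c)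
    (hy : ∀ᶠ z in nhds y, inner ℝ v z = c → z ∈ W) :
    {x ∈ W | inner ℝ v x = c} ∈ facets W := by
  set F := {x ∈ W | inner ℝ v x = c} with hF
  have hyF : y ∈ F := ⟨hy.self_of_nhds hyc, hyc⟩
  refine ⟨fun _ => ⟨innerSL ℝ v, ?_⟩, ⟨y, hyF⟩, ?_⟩
  · ext x
    simp only [hF, mem_ofPred_eq, innerSL_apply_apply]
    refine and_congr_right fun hx => ⟨fun h z hz => h ▸ hW z hz, fun h => ?_⟩
    exact le_antisymm (hW x hx) (hyc ▸ h y hyF.1)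
  · have hspan : vectorSpan ℝ F = (ℝ ∙ v)ᗮ := by
      apply le_antisymm
      · rw [vectorSpan, Submodule.span_le]
        rintro _ ⟨a, ha, b, hb, rfl⟩
        rw [SetLike.mem_coe, Submodule.mem_orthogonal_singleton_iff_inner_right]
        change inner ℝ v (a - b) = 0
        rw [inner_sub_right, ha.2, hb.2, sub_self]
      · intro w hw
        rw [Submodule.mem_orthogonal_singleton_iff_inner_right] at hw
        have hcont : Filter.Tendsto (fun ε : ℝ => y + ε • w) (nhdsWithin 0 (Ioi 0)) (nhds y) := by
          have : Continuous fun ε : ℝ => y + ε • w := by fun_prop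
          simpa using (this.tendsto 0).mono_left nhdsWithin_le_nhds
        obtain ⟨ε, hε, hεpos⟩ := ((hcont.eventually hy).and self_mem_nhdsWithin).exists
        have hεc : inner ℝ v (y + ε • w) = c := by
          rw [inner_add_right, real_inner_smul_right, hw, hyc, mul_zero, add_zero]
        have h1 := vsub_mem_vectorSpan ℝ (show y + ε • w ∈ F from ⟨hε hεc, hεc⟩) hyF
        rw [vsub_eq_sub, add_sub_cancel_left] at h1
        exact (Submodule.smul_mem_iff _ (ne_of_gt hεpos)).1 h1
    rw [hspan]
    have h1 := Submodule.finrank_add_finrank_orthogonal (ℝ ∙ v)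
    rw [finrank_span_singleton hv, finrank_euclideanSpace_fin] at h1
    omega

/-- The boundary of a polytope is covered by its facets.  In a description by a minimal number of
linear constraints every constraint defines a facet: dropping it admits a new point `z`, and the
segment from an interior point to `z` leaves `W` through a point where only this constraint is
active. -/
lemma exists_facet_mem {W : Set (E n)} (hW : IsWindow W) {x : E n} (hx : x ∈ W)
    (hxi : x ∉ interior W) : ∃ F ∈ facets W, x ∈ F := by
  classical
  obtain ⟨s₀, hs₀⟩ := hW.polyhedral
  obtain ⟨s, hs, hmin⟩ := exists_minimalFor_of_wellFoundedLT
    (fun s : Finset (E n × ℝ) => W = {x | ∀ p ∈ s, inner ℝ p.1 x ≤ p.2}) Finset.card ⟨s₀, hs₀⟩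
  have hdrop : ∀ p ∈ s, ∃ z, z ∉ W ∧ ∀ r ∈ s, r ≠ p → inner ℝ r.1 z ≤ r.2 := by
    intro p hp
    by_contra! hcon
    have hs' : W = {x | ∀ r ∈ s.erase p, inner ℝ r.1 x ≤ r.2} := by
      apply Subset.antisymm
      · intro z hz r hr
        rw [hs] at hz
        exact hz r (Finset.mem_of_mem_erase hr)
      · intro z hz
        by_contra hzW
        obtain ⟨r, hr, hrp, hlt⟩ := hcon z hzW
        exact hlt.not_ge (hz r (Finset.mem_erase.2 ⟨hrp, hr⟩))
    have h1 := hmin hs' (Finset.card_le_card (Finset.erase_subset p s))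
    exact h1.not_gt (Finset.card_erase_lt_of_mem hp)
  obtain ⟨w, hw⟩ := hW.interior_nonempty
  have hle : ∀ p ∈ s, ∀ z ∈ W, inner ℝ p.1 z ≤ p.2 := by
    intro p hp z hz
    rw [hs] at hz
    exact hz p hp
  have hne : ∀ p ∈ s, p.1 ≠ 0 := by
    intro p hp h0
    obtain ⟨z, hzW, hz⟩ := hdrop p hp
    refine hzW ?_
    rw [hs]
    intro r hr
    by_cases hrp : r = p
    · have := hle p hp w (interior_subset hw)
      rw [hrp, h0, inner_zero_left]
      rwa [h0, inner_zero_left] at this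
    · exact hz r hr hrp
  have hstrict : ∀ p ∈ s, inner ℝ p.1 w < p.2 := fun p hp =>
    inner_lt_of_mem_interior (hne p hp) (hle p hp) hw
  have hopen : ∀ t : Finset (E n × ℝ), IsOpen {z : E n | ∀ p ∈ t, inner ℝ p.1 z < p.2} := by
    intro t
    have : {z : E n | ∀ p ∈ t, inner ℝ p.1 z < p.2} = ⋂ p ∈ t, {z | inner ℝ p.1 z < p.2} := by
      ext; simp
    rw [this]
    exact isOpen_biInter_finset fun p _ => isOpen_lt (by fun_prop) (by fun_prop)
  obtain ⟨p, hp, hpx⟩ : ∃ p ∈ s, inner ℝ p.1 x = p.2 := by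
    by_contra! hcon
    refine hxi (mem_interior.2 ⟨_, ?_, hopen s, fun p hp => lt_of_le_of_ne (hle p hp x hx)
      (hcon p hp)⟩)
    intro z hz
    rw [hs]
    exact fun p hp => (hz p hp).le
  obtain ⟨z, hzW, hz⟩ := hdrop p hp
  have hpz : p.2 < inner ℝ p.1 z := by
    by_contra! hcon
    refine hzW ?_
    rw [hs]
    intro r hr
    by_cases hrp : r = p
    · rw [hrp]; exact hcon
    · exact hz r hr hrp
  have hpw := hstrict p hp
  -- the point at which the segment from `w` to `z` crosses the hyperplane
  set θ : ℝ := (p.2 - inner ℝ p.1 w) / (inner ℝ p.1 z - inner ℝ p.1 w) with hθ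
  have hden : 0 < inner ℝ p.1 z - inner ℝ p.1 w := by linarith
  have hθ0 : 0 ≤ θ := div_nonneg (by linarith) hden.le
  have hθ1 : θ < 1 := (div_lt_one hden).2 (by linarith)
  set y : E n := w + θ • (z - w) with hy
  have hin : ∀ v : E n, inner ℝ v y = inner ℝ v w + θ * (inner ℝ v z - inner ℝ v w) := by
    intro v
    rw [hy, inner_add_right, real_inner_smul_right, inner_sub_right]
  have hyc : inner ℝ p.1 y = p.2 := by
    rw [hin, hθ, div_mul_cancel₀ _ hden.ne']; ring
  have hyr : y ∈ {y : E n | ∀ r ∈ s.erase p, inner ℝ r.1 y < r.2} := by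
    intro r hr
    obtain ⟨hrp, hr⟩ := Finset.mem_erase.1 hr
    rw [hin]
    have h1 := hstrict r hr
    have h2 := hz r hr hrp
    nlinarith
  refine ⟨_, mem_facets_of_eventually (hne p hp) (hle p hp) hyc ?_, hx, hpx⟩
  filter_upwards [(hopen (s.erase p)).mem_nhds hyr] with u hu hup
  rw [hs]
  intro r hr
  by_cases hrp : r = p
  · rw [hrp]; exact hup.le
  · exact (hu r (Finset.mem_erase.2 ⟨hrp, hr⟩)).le

/-- A window has a facet. -/
lemma facets_nonempty (hn : 1 ≤ n) {W : Set (E n)} (hW : IsWindow W) : (facets W).Nonempty := by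
  by_contra hcon
  rw [not_nonempty_iff_eq_empty] at hcon
  have hopen : IsOpen W := by
    rw [← interior_eq_iff_isOpen]
    refine interior_subset.antisymm fun x hx => ?_
    by_contra hxi
    obtain ⟨F, hF, -⟩ := exists_facet_mem hW hx hxi
    rw [hcon] at hF
    exact hF
  have huniv := IsClopen.eq_univ ⟨hW.isCompact.isClosed, hopen⟩
    (hW.interior_nonempty.mono interior_subset)
  have : Nonempty (Fin n) := ⟨⟨0, hn⟩⟩
  have hc := hW.isCompact
  rw [huniv] at hc
  exact noncompact_univ (E n) hc

lemma subset_interior_of_disjoint_facets {W C : Set (E n)} (hW : IsWindow W) (hCW : C ⊆ W)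
    (hC : ∀ F ∈ facets W, Disjoint C F) : C ⊆ interior W := by
  intro x hx
  by_contra hxi
  obtain ⟨F, hF, hxF⟩ := exists_facet_mem hW (hCW hx) hxi
  exact disjoint_left.1 (hC F hF) hx hxF

/-! ### Random cells -/

/-- `C θ` is a random cell: the polytope `W` cut by finitely many half-spaces
`⟪v θ, x⟫ ≤ ‖v θ‖²` that depend measurably on `θ`. -/
def IsRandomCell {Θ : Type*} [MeasurableSpace Θ] (W : Set (E n)) (C : Θ → Set (E n)) : Prop :=
  ∃ L : List (Θ → E n), (∀ v ∈ L, Measurable v) ∧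
    ∀ θ, C θ = {x ∈ W | ∀ v ∈ L, inner ℝ (v θ) x ≤ ‖v θ‖ ^ 2}

namespace IsRandomCell

variable {Θ : Type*} [MeasurableSpace Θ] {W : Set (E n)} {C : Θ → Set (E n)}

lemma const (W : Set (E n)) : IsRandomCell W fun _ : Θ => W :=
  ⟨[], by simp, by simp⟩

lemma comp {Θ' : Type*} [MeasurableSpace Θ'] (hC : IsRandomCell W C) {φ : Θ' → Θ}
    (hφ : Measurable φ) : IsRandomCell W fun θ => C (φ θ) := by
  obtain ⟨L, hL, hC⟩ := hC
  refine ⟨L.map fun v => v ∘ φ, ?_, fun θ => ?_⟩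
  · simp only [List.mem_map, forall_exists_index, and_imp, forall_apply_eq_imp_iff₂]
    exact fun v hv => (hL v hv).comp hφ
  · beta_reduce
    rw [hC]; simp

lemma inter_halfSpace (hC : IsRandomCell W C) {D : Θ → Hyperplane n} (hD : Measurable D) :
    IsRandomCell W fun θ => C θ ∩ (D θ).halfSpace true := by
  obtain ⟨L, hL, hC⟩ := hC
  refine ⟨(fun θ => (D θ).foot) :: L, ?_, fun θ => ?_⟩
  · simp only [List.mem_cons, forall_eq_or_imp]
    exact ⟨measurable_foot.comp hD, hL⟩
  · beta_reduce
    rw [hC, Hyperplane.halfSpace_true]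
    ext x
    simp only [mem_inter_iff, mem_ofPred_eq, List.mem_cons, forall_eq_or_imp]
    tauto

lemma zero_mem (hC : IsRandomCell W C) (h0 : (0 : E n) ∈ W) (θ : Θ) : (0 : E n) ∈ C θ := by
  obtain ⟨L, -, hC⟩ := hC
  rw [hC]
  refine ⟨h0, fun v _ => ?_⟩
  rw [inner_zero_right]
  positivity

/-- Whether a random hyperplane hits a random cell is a measurable event: in terms of the feet it
is a closed condition, because `W` is compact. -/
lemma measurableSet_mem_hitting (hC : IsRandomCell W C) (hW : IsCompact W) (h0 : (0 : E n) ∈ W)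
    {D : Θ → Hyperplane n} (hD : Measurable D) : MeasurableSet {θ | D θ ∈ hitting (C θ)} := by
  have h0' := hC.zero_mem h0
  obtain ⟨L, hL, hC⟩ := hC
  have hcomp : CompactSpace W := isCompact_iff_compactSpace.1 hW
  let K : Set (((Fin L.length → E n) × E n) × W) :=
    {z | (∀ i, inner ℝ (z.1.1 i) (z.2 : E n) ≤ ‖z.1.1 i‖ ^ 2) ∧
      inner ℝ z.1.2 (z.2 : E n) = ‖z.1.2‖ ^ 2}
  have hK : IsClosed K := by
    have : K = (⋂ i, {z | inner ℝ (z.1.1 i) (z.2 : E n) ≤ ‖z.1.1 i‖ ^ 2}) ∩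
        {z | inner ℝ z.1.2 (z.2 : E n) = ‖z.1.2‖ ^ 2} := by
      ext; simp [K]
    rw [this]
    exact (isClosed_iInter fun i => isClosed_le (by fun_prop) (by fun_prop)).inter
      (isClosed_eq (by fun_prop) (by fun_prop))
  have hK' : IsClosed (Prod.fst '' K) := isClosedMap_fst_of_compactSpace _ hK
  have hφ : Measurable fun θ => ((fun i : Fin L.length => L.get i θ), (D θ).foot) :=
    (measurable_pi_lambda _ fun i => hL _ (L.get_mem i)).prodMk (measurable_foot.comp hD)
  convert hφ hK'.measurableSet using 1
  ext θ
  rw [mem_ofPred_eq, mem_hitting_iff_foot (h0' θ), hC]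
  constructor
  · rintro ⟨x, ⟨hxW, hx⟩, hxD⟩
    exact ⟨(_, ⟨x, hxW⟩), ⟨fun i => hx _ (L.get_mem i), hxD⟩, rfl⟩
  · rintro ⟨⟨z, x⟩, ⟨h1, h2⟩, rfl⟩
    refine ⟨x, ⟨x.2, fun v hv => ?_⟩, h2⟩
    obtain ⟨i, rfl⟩ := List.get_of_mem hv
    exact h1 i

end IsRandomCell

/-! ### Collecting separating hyperplanes -/

/-- The reindexing of the input after a hyperplane has been rejected: the current sequence loses
its first term. -/
def rejectIdx (p : ℕ × ℕ) : ℕ × ℕ := (p.1, (if p.1 = 0 then 1 else 0) + p.2)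

/-- The reindexing of the input after a hyperplane has divided the cell: the current sequence is
given up, and the next one takes its place. -/
def acceptIdx (p : ℕ × ℕ) : ℕ × ℕ := (p.1 + 1, p.2)

lemma rejectIdx_injective : Function.Injective rejectIdx := by
  rintro ⟨i, m⟩ ⟨j, k⟩ h
  simp only [rejectIdx, Prod.mk.injEq] at h
  obtain ⟨rfl, h⟩ := h
  simpa using h

lemma acceptIdx_injective : Function.Injective acceptIdx := by
  rintro ⟨i, m⟩ ⟨j, k⟩ h
  simpa [acceptIdx] using h

lemma rejectIdx_ne_zero (p : ℕ × ℕ) : rejectIdx p ≠ (0, 0) := by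
  obtain ⟨_ | i, m⟩ := p <;> simp [rejectIdx]

lemma acceptIdx_ne_zero (p : ℕ × ℕ) : acceptIdx p ≠ (0, 0) := by
  simp [acceptIdx]

open Classical in
/-- The members of `J` that are still missing after the hyperplane `H` has arrived, which supplies
those indices `a` for which `H ∈ G a`. -/
def missing {q : ℕ} (G : Fin q → Set (Hyperplane n)) (J : Finset (Fin q)) (H : Hyperplane n) :
    Finset (Fin q) :=
  J.filter fun a => H ∉ G a

lemma mem_missing {q : ℕ} {G : Fin q → Set (Hyperplane n)} {J : Finset (Fin q)}
    {H : Hyperplane n} {a : Fin q} : a ∈ missing G J H ↔ a ∈ J ∧ H ∉ G a := by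
  simp [missing]

/-- `Collects W' G N C J t y`: starting from the cell `C`, at most `N` steps of the construction
with the marked hyperplanes `y`, taking together at most the time `t`, bring a hyperplane from
`G a` for every `a ∈ J`, and none of these steps brings a hyperplane that hits `W'`.  The row
`y (i, ·)` is used by the `i`-th successor of `C` on the side of the origin. -/
def Collects {q : ℕ} (W' : Set (E n)) (G : Fin q → Set (Hyperplane n)) :
    ℕ → Set (E n) → Finset (Fin q) → ℝ → (ℕ × ℕ → Hyperplane n × ℝ) → Prop
  | 0, _, J, _, _ => J = ∅
  | N + 1, C, J, t, y => J = ∅ ∨ (((y (0, 0)).2 ∈ Icc 0 t ∧ (y (0, 0)).1 ∉ hitting W') ∧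
      (((y (0, 0)).1 ∈ hitting C ∧
        Collects W' G N (C ∩ (y (0, 0)).1.halfSpace true) (missing G J (y (0, 0)).1)
          (t - (y (0, 0)).2) (fun p => y (acceptIdx p))) ∨
      ((y (0, 0)).1 ∉ hitting C ∧
        Collects W' G N C (missing G J (y (0, 0)).1)
          (t - (y (0, 0)).2) (fun p => y (rejectIdx p)))))

lemma measurableSet_missing_eq {q : ℕ} {G : Fin q → Set (Hyperplane n)}
    (hG : ∀ a, MeasurableSet (G a)) (J K : Finset (Fin q)) :
    MeasurableSet {H | missing G J H = K} := by
  have : {H | missing G J H = K} =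
      ⋂ a, {H | (a ∈ J ∧ H ∉ G a) ↔ a ∈ K} := by
    ext H
    simp [mem_missing, Finset.ext_iff]
  rw [this]
  refine MeasurableSet.iInter fun a => ?_
  by_cases haJ : a ∈ J <;> by_cases haK : a ∈ K <;> simp only [haJ, haK, true_and, false_and,
    iff_true, iff_false, not_not] <;> first | exact (hG a).compl | exact hG a | simp

lemma measurableSet_collects {q : ℕ} {W W' : Set (E n)} (hW : IsCompact W)
    (hW' : IsCompact W') (h0 : (0 : E n) ∈ W) {G : Fin q → Set (Hyperplane n)}
    (hG : ∀ a, MeasurableSet (G a)) {Θ : Type*} [MeasurableSpace Θ] (N : ℕ) :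
    ∀ (J : Finset (Fin q)) (C : Θ → Set (E n)) (t : Θ → ℝ)
      (y : Θ → ℕ × ℕ → Hyperplane n × ℝ), IsRandomCell W C → Measurable t →
      Measurable y → MeasurableSet {θ | Collects W' G N (C θ) J (t θ) (y θ)} := by
  induction N with
  | zero => intro J C t y _ _ _; simp only [Collects]; exact MeasurableSet.const _
  | succ N ih =>
    intro J C t y hC ht hy
    have hy0 : Measurable fun θ => y θ (0, 0) := (measurable_pi_apply _).comp hy
    have hy' : ∀ e : ℕ × ℕ → ℕ × ℕ, Measurable fun θ => fun p => y θ (e p) := fun e =>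
      measurable_pi_lambda _ fun p => (measurable_pi_apply _).comp hy
    -- the set of missing indices takes finitely many values
    have hsplit : ∀ (C' : Θ → Set (E n)) (e : ℕ × ℕ → ℕ × ℕ), IsRandomCell W C' →
        MeasurableSet {θ | Collects W' G N (C' θ) (missing G J (y θ (0, 0)).1)
          (t θ - (y θ (0, 0)).2) (fun p => y θ (e p))} := by
      intro C' e hC'
      have : {θ | Collects W' G N (C' θ) (missing G J (y θ (0, 0)).1)
          (t θ - (y θ (0, 0)).2) (fun p => y θ (e p))} =
          ⋃ K : Finset (Fin q), {θ | missing G J (y θ (0, 0)).1 = K} ∩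
            {θ | Collects W' G N (C' θ) K (t θ - (y θ (0, 0)).2) (fun p => y θ (e p))} := by
        ext θ; simp
      rw [this]
      exact MeasurableSet.iUnion fun K =>
        (hy0.fst (measurableSet_missing_eq hG J K)).inter
          (ih K C' _ _ hC' (ht.sub hy0.snd) (hy' e))
    have hhit := hC.measurableSet_mem_hitting hW h0 hy0.fst
    simp only [Collects]
    refine (MeasurableSet.const _).union (((?_ : MeasurableSet _).inter ?_).inter
      ((hhit.inter (hsplit _ _ (hC.inter_halfSpace hy0.fst))).union
        (hhit.compl.inter (hsplit _ _ hC))))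
    · exact (measurableSet_le measurable_const hy0.snd).inter (measurableSet_le hy0.snd ht)
    · exact (hy0.fst (measurableSet_hitting hW')).compl

/-! ### The bound as a solution of a renewal equation -/

section Bound

variable {ι : Type*} (r : ℝ) (l : ι → ℝ)

/-- The probability that independent exponential times with rates `l a`, `a ∈ J`, are all over at
time `t`. -/
def allArrived (J : Finset ι) (t : ℝ) : ℝ := ∏ a ∈ J, (1 - Real.exp (-t * l a))

/-- The probability that independent exponential times with rates `l a`, `a ∈ J`, are all over at
time `t` and before a further one with rate `r`. -/
def collectBound (J : Finset ι) (t : ℝ) : ℝ :=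
  Real.exp (-t * r) * allArrived l J t +
    ∫ x in (0 : ℝ)..t, r * Real.exp (-x * r) * allArrived l J x

lemma allArrived_zero {J : Finset ι} (hJ : J ≠ ∅) : allArrived l J 0 = 0 := by
  obtain ⟨a, ha⟩ := Finset.nonempty_iff_ne_empty.2 hJ
  exact Finset.prod_eq_zero ha (by simp)

lemma collectBound_zero (J : Finset ι) : collectBound r l J 0 = allArrived l J 0 := by
  simp [collectBound]

lemma allArrived_le_one {l : ι → ℝ} (hl : ∀ a, 0 ≤ l a) (J : Finset ι) {t : ℝ} (ht : 0 ≤ t) :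
    allArrived l J t ≤ 1 := by
  refine Finset.prod_le_one (fun a _ => ?_) fun a _ => ?_
  · rw [sub_nonneg, Real.exp_le_one_iff]
    have := mul_nonneg ht (hl a)
    linarith
  · linarith [Real.exp_pos (-t * l a)]

variable [DecidableEq ι]

/-- The derivative of `allArrived`. -/
def allArrivedDeriv (J : Finset ι) (t : ℝ) : ℝ :=
  ∑ a ∈ J, l a * (allArrived l (J.erase a) t - allArrived l J t)

lemma hasDerivAt_exp_neg_mul (c t : ℝ) :
    HasDerivAt (fun t => Real.exp (-t * c)) (-(c * Real.exp (-t * c))) t := by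
  refine ((hasDerivAt_neg t).mul_const c).exp.congr_deriv ?_
  ring

lemma hasDerivAt_allArrived (J : Finset ι) (t : ℝ) :
    HasDerivAt (allArrived l J) (allArrivedDeriv l J t) t := by
  have h := HasDerivAt.fun_finsetProd (u := J) (f := fun a t => 1 - Real.exp (-t * l a))
    (f' := fun a => l a * Real.exp (-t * l a)) (x := t) fun a _ => by
      simpa using (hasDerivAt_exp_neg_mul (l a) t).const_sub 1
  refine h.congr_deriv ?_
  refine Finset.sum_congr rfl fun a ha => ?_
  rw [smul_eq_mul, allArrived, allArrived, ← Finset.mul_prod_erase J _ ha]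
  ring

lemma continuous_allArrived (J : Finset ι) : Continuous (allArrived l J) :=
  continuous_iff_continuousAt.2 fun t => (hasDerivAt_allArrived l J t).continuousAt

lemma hasDerivAt_collectBound (J : Finset ι) (t : ℝ) :
    HasDerivAt (collectBound r l J) (Real.exp (-t * r) * allArrivedDeriv l J t) t := by
  have hc : Continuous fun x => r * Real.exp (-x * r) * allArrived l J x :=
    (by fun_prop : Continuous fun x : ℝ => r * Real.exp (-x * r)).mul (continuous_allArrived l J)
  have h := ((hasDerivAt_exp_neg_mul r t).mul (hasDerivAt_allArrived l J t)).add
    (intervalIntegral.integral_hasDerivAt_right (hc.intervalIntegrable 0 t)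
      (hc.stronglyMeasurableAtFilter _ _) hc.continuousAt)
  refine h.congr_deriv ?_
  ring

lemma continuous_collectBound (J : Finset ι) : Continuous (collectBound r l J) :=
  continuous_iff_continuousAt.2 fun t => (hasDerivAt_collectBound r l J t).continuousAt

lemma hasDerivAt_allArrivedDeriv (J : Finset ι) (t : ℝ) :
    HasDerivAt (allArrivedDeriv l J)
      (∑ a ∈ J, l a * (allArrivedDeriv l (J.erase a) t - allArrivedDeriv l J t)) t :=
  HasDerivAt.fun_sum fun _ _ =>
    ((hasDerivAt_allArrived l _ t).sub (hasDerivAt_allArrived l _ t)).const_mul _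

/-- The Kolmogorov equation of the bound. -/
lemma collectBound_kolmogorov {J : Finset ι} (hJ : J ≠ ∅) (t : ℝ) :
    Real.exp (-t * r) * allArrivedDeriv l J t =
      ∑ a ∈ J, l a * (collectBound r l (J.erase a) t - collectBound r l J t) -
        r * collectBound r l J t := by
  -- the difference of the two sides has derivative zero and vanishes at `0`
  set V : ℝ → ℝ := fun t => ∑ a ∈ J, l a * (collectBound r l (J.erase a) t -
    collectBound r l J t) - r * collectBound r l J t - Real.exp (-t * r) * allArrivedDeriv l J t
    with hV
  have hder : ∀ t, HasDerivAt V 0 t := by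
    intro t
    have h := ((HasDerivAt.fun_sum fun a (_ : a ∈ J) =>
      ((hasDerivAt_collectBound r l (J.erase a) t).sub
        (hasDerivAt_collectBound r l J t)).const_mul (l a)).sub
      ((hasDerivAt_collectBound r l J t).const_mul r)).sub
      ((hasDerivAt_exp_neg_mul r t).mul (hasDerivAt_allArrivedDeriv l J t))
    refine h.congr_deriv ?_
    rw [Finset.mul_sum]
    simp_rw [← mul_sub, mul_left_comm (l _) (Real.exp _)]
    ring
  have h0 : V 0 = 0 := by
    simp only [hV, collectBound_zero, allArrived_zero l hJ, allArrivedDeriv]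
    simp
  have hconst := is_const_of_deriv_eq_zero (f := V) (fun x => (hder x).differentiableAt)
    (fun x => (hder x).deriv) t 0
  rw [h0] at hconst
  simp only [hV] at hconst
  linarith

/-- The renewal equation of the bound: a decomposition at the first event of a Poisson process of
rate `c`. -/
lemma collectBound_renewal (c : ℝ) {J : Finset ι} (hJ : J ≠ ∅) (t : ℝ) :
    ∫ s in (0 : ℝ)..t, Real.exp (-s * c) *
      (∑ a ∈ J, l a * (collectBound r l (J.erase a) (t - s) - collectBound r l J (t - s)) +
        (c - r) * collectBound r l J (t - s)) = collectBound r l J t := by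
  have hder : ∀ s, HasDerivAt (fun s => -(Real.exp (-s * c) * collectBound r l J (t - s)))
      (Real.exp (-s * c) *
      (∑ a ∈ J, l a * (collectBound r l (J.erase a) (t - s) - collectBound r l J (t - s)) +
        (c - r) * collectBound r l J (t - s))) s := by
    intro s
    have h1 : HasDerivAt (fun s => t - s) (-1) s := by
      simpa using (hasDerivAt_id s).const_sub t
    have h := ((hasDerivAt_exp_neg_mul c s).mul
      ((hasDerivAt_collectBound r l J (t - s)).comp s h1)).neg
    refine h.congr_deriv ?_
    rw [collectBound_kolmogorov r l hJ, Function.comp_apply]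
    ring
  have hcont : ∀ K : Finset ι, Continuous fun s => collectBound r l K (t - s) := fun K =>
    (continuous_collectBound r l K).comp (by fun_prop)
  rw [intervalIntegral.integral_eq_sub_of_hasDerivAt (fun s _ => hder s)]
  · simp [collectBound_zero, allArrived_zero l hJ]
  · refine Continuous.intervalIntegrable ?_ _ _
    fun_prop

variable {r l}

lemma integral_rate_mul_exp (r t : ℝ) :
    ∫ x in (0 : ℝ)..t, r * Real.exp (-x * r) = 1 - Real.exp (-t * r) := by
  rw [intervalIntegral.integral_eq_sub_of_hasDerivAt (f := fun x => -Real.exp (-x * r))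
    (fun s _ => (hasDerivAt_exp_neg_mul r s).neg.congr_deriv (neg_neg _))
    (Continuous.intervalIntegrable (by fun_prop) _ _)]
  simp
  ring

lemma collectBound_le_one (hr : 0 ≤ r) (hl : ∀ a, 0 ≤ l a) (J : Finset ι) {t : ℝ}
    (ht : 0 ≤ t) : collectBound r l J t ≤ 1 := by
  have h1 := integral_rate_mul_exp r t
  have hc := continuous_allArrived l J
  have h2 : ∫ x in (0 : ℝ)..t, r * Real.exp (-x * r) * allArrived l J x ≤
      ∫ x in (0 : ℝ)..t, r * Real.exp (-x * r) := by
    refine intervalIntegral.integral_mono_on ht (Continuous.intervalIntegrable (by fun_prop) _ _)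
      (Continuous.intervalIntegrable (by fun_prop) _ _) fun x hx => ?_
    exact mul_le_of_le_one_right (by positivity) (allArrived_le_one hl J hx.1)
  have h3 := mul_le_of_le_one_right (Real.exp_pos (-t * r)).le (allArrived_le_one hl J ht)
  rw [collectBound]
  linarith

end Bound

/-! ### The exponential distribution -/

lemma setIntegral_expMeasure {c : ℝ} (hc : 0 < c) {t : ℝ} (ht : 0 ≤ t) (f : ℝ → ℝ) :
    ∫ s in Icc 0 t, f s ∂(expMeasure c) = ∫ s in (0 : ℝ)..t, c * Real.exp (-s * c) * f s := by
  have h : expMeasure c = volume.withDensity (exponentialPDF c) := rfl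
  rw [h, setIntegral_withDensity_eq_setIntegral_toReal_smul
    (f := exponentialPDF c) (measurable_exponentialPDFReal c).ennreal_ofReal
    (Filter.Eventually.of_forall fun _ => ENNReal.ofReal_lt_top) f measurableSet_Icc,
    intervalIntegral.integral_of_le ht, integral_Icc_eq_integral_Ioc]
  refine setIntegral_congr_fun measurableSet_Ioc fun s hs => ?_
  have hs0 : 0 ≤ s := hs.1.le
  rw [exponentialPDF_of_nonneg hs0, ENNReal.toReal_ofReal (by positivity), smul_eq_mul,
    neg_mul, mul_comm s c]

lemma expMeasure_Iic_zero {c : ℝ} (hc : 0 < c) : expMeasure c (Iic 0) = 0 := by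
  have := isProbabilityMeasure_expMeasure hc
  have h := cdf_expMeasure_eq hc 0
  rw [cdf_eq_real] at h
  simpa [measureReal_eq_zero_iff] using h

/-! ### The probability of collecting all separating hyperplanes -/

lemma missing_eq_erase {q : ℕ} {G : Fin q → Set (Hyperplane n)}
    (hG : Pairwise fun a b => Disjoint (G a) (G b)) (J : Finset (Fin q)) {H : Hyperplane n}
    {a : Fin q} (ha : H ∈ G a) : missing G J H = J.erase a := by
  ext b
  rw [mem_missing, Finset.mem_erase, and_comm]
  refine and_congr_left fun _ => ⟨fun h hab => h (hab ▸ ha), fun hba hb => ?_⟩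
  exact disjoint_left.1 (hG hba) hb ha

/-- The bound for the probability of success, as a function of the hyperplane and of the waiting
time of the next step: what remains to be collected in the remaining time, up to an error `κ`. -/
def stepBound {q : ℕ} (W' : Set (E n)) (G : Fin q → Set (Hyperplane n)) (r : ℝ) (l : Fin q → ℝ)
    (κ : ℝ) (J : Finset (Fin q)) (t : ℝ) (a : Hyperplane n × ℝ) : ℝ :=
  (Icc 0 t).indicator (fun s => (hitting W')ᶜ.indicator
    (fun D => collectBound r l (missing G J D) (t - s) - κ) a.1) a.2

lemma stepBound_eq {q : ℕ} {W' : Set (E n)} {G : Fin q → Set (Hyperplane n)}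
    (hG : Pairwise fun a b => Disjoint (G a) (G b)) (hGW : ∀ a, Disjoint (G a) (hitting W'))
    (r : ℝ) (l : Fin q → ℝ) (κ : ℝ) (J : Finset (Fin q)) (t : ℝ) :
    stepBound W' G r l κ J t = fun z =>
      ∑ a ∈ J, (G a).indicator 1 z.1 * (Icc 0 t).indicator
          (fun s => collectBound r l (J.erase a) (t - s) - collectBound r l J (t - s)) z.2 +
        (hitting W')ᶜ.indicator 1 z.1 *
          (Icc 0 t).indicator (fun s => collectBound r l J (t - s) - κ) z.2 := by
  funext ⟨D, s⟩
  rw [stepBound]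
  by_cases hs : s ∈ Icc 0 t
  swap
  · simp [indicator_of_notMem hs]
  simp only [indicator_of_mem hs]
  by_cases hex : ∃ a, D ∈ G a
  · obtain ⟨a, ha⟩ := hex
    have hDW : D ∈ (hitting W')ᶜ := disjoint_left.1 (hGW a) ha
    have hb : ∀ b ∈ J, b ≠ a → (G b).indicator (1 : Hyperplane n → ℝ) D *
        (collectBound r l (J.erase b) (t - s) - collectBound r l J (t - s)) = 0 := by
      intro b _ hba
      rw [indicator_of_notMem fun hb => disjoint_left.1 (hG hba) hb ha, zero_mul]
    rw [indicator_of_mem hDW, indicator_of_mem hDW, missing_eq_erase hG J ha]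
    by_cases haJ : a ∈ J
    · rw [Finset.sum_eq_single_of_mem a haJ hb, indicator_of_mem ha]
      simp
    · rw [Finset.sum_eq_zero fun b hbJ => hb b hbJ fun h => haJ (h ▸ hbJ),
        Finset.erase_eq_of_notMem haJ]
      simp
  · push Not at hex
    have h1 : missing G J D = J := by
      ext a
      simp [mem_missing, hex a]
    rw [Finset.sum_eq_zero fun a _ => by rw [indicator_of_notMem (hex a), zero_mul]]
    by_cases hDW : D ∈ (hitting W')ᶜ
    · simp [indicator_of_mem hDW, h1]
    · simp [indicator_of_notMem hDW]

section Integral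

variable {q : ℕ} {W' : Set (E n)} {G : Fin q → Set (Hyperplane n)} {ν : Measure (Hyperplane n)}
  [IsProbabilityMeasure ν] {c r : ℝ} {l : Fin q → ℝ}

/-- One step of the induction: the renewal equation turns the integral of `stepBound` into the
bound itself, up to the contracted error `κ`. -/
lemma integral_stepBound (hc : 0 < c) (hW' : IsCompact W')
    (hGm : ∀ a, MeasurableSet (G a)) (hG : Pairwise fun a b => Disjoint (G a) (G b))
    (hGW : ∀ a, Disjoint (G a) (hitting W')) (hr : c * ν.real (hitting W') = r)
    (hl : ∀ a, c * ν.real (G a) = l a) (κ : ℝ) {J : Finset (Fin q)} (hJ : J ≠ ∅) {t : ℝ}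
    (ht : 0 ≤ t) :
    Integrable (stepBound W' G r l κ J t) (ν.prod (expMeasure c)) ∧
    ∫ z, stepBound W' G r l κ J t z ∂(ν.prod (expMeasure c)) =
      collectBound r l J t - (1 - ν.real (hitting W')) * κ * (1 - Real.exp (-t * c)) := by
  have := isProbabilityMeasure_expMeasure hc
  have hWm := measurableSet_hitting hW'
  have hR : ∀ K : Finset (Fin q), Continuous fun s => collectBound r l K (t - s) := fun K =>
    (continuous_collectBound r l K).comp (by fun_prop)
  have hφ : ∀ A : Set (Hyperplane n), MeasurableSet A →
      Integrable (A.indicator (1 : Hyperplane n → ℝ)) ν := fun A hA =>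
    (integrable_const (1 : ℝ)).indicator hA
  have hψ : ∀ f : ℝ → ℝ, Continuous f → Integrable ((Icc 0 t).indicator f) (expMeasure c) :=
    fun f hf => (integrable_indicator_iff measurableSet_Icc).2
      (hf.continuousOn.integrableOn_compact isCompact_Icc)
  have hI : ∀ f : ℝ → ℝ, ∫ s, (Icc 0 t).indicator f s ∂(expMeasure c) =
      ∫ s in (0 : ℝ)..t, c * Real.exp (-s * c) * f s := fun f => by
    rw [integral_indicator measurableSet_Icc, setIntegral_expMeasure hc ht]
  have hint1 : ∀ a ∈ J, Integrable (fun z : Hyperplane n × ℝ => (G a).indicator 1 z.1 *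
      (Icc 0 t).indicator (fun s => collectBound r l (J.erase a) (t - s) -
        collectBound r l J (t - s)) z.2) (ν.prod (expMeasure c)) := fun a _ =>
    (hφ _ (hGm a)).mul_prod (hψ _ ((hR _).sub (hR _)))
  have hint2 : Integrable (fun z : Hyperplane n × ℝ => (hitting W')ᶜ.indicator 1 z.1 *
      (Icc 0 t).indicator (fun s => collectBound r l J (t - s) - κ) z.2)
      (ν.prod (expMeasure c)) :=
    (hφ _ hWm.compl).mul_prod (hψ _ ((hR _).sub continuous_const))
  rw [stepBound_eq hG hGW]
  refine ⟨(integrable_finsetSum _ hint1).add hint2, ?_⟩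
  rw [integral_add (integrable_finsetSum _ hint1) hint2, integral_finsetSum _ hint1]
  simp_rw [integral_prod_mul, integral_indicator_one (hGm _), integral_indicator_one hWm.compl, hI]
  rw [probReal_compl_eq_one_sub hWm]
  have hexp : Continuous fun s => c * Real.exp (-s * c) := by fun_prop
  have hc1 : ∀ a, Continuous fun s => ν.real (G a) * (c * Real.exp (-s * c) *
      (collectBound r l (J.erase a) (t - s) - collectBound r l J (t - s))) := fun a =>
    (hexp.mul ((hR (J.erase a)).sub (hR J))).const_mul _
  have hc2 : Continuous fun s => c * Real.exp (-s * c) * collectBound r l J (t - s) :=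
    hexp.mul (hR J)
  have hc3 : Continuous fun s => κ * (c * Real.exp (-s * c)) := hexp.const_mul κ
  have hc4 : Continuous fun s => (1 - ν.real (hitting W')) *
      (c * Real.exp (-s * c) * collectBound r l J (t - s)) := hc2.const_mul _
  have hc5 : Continuous fun s => ∑ a ∈ J, ν.real (G a) * (c * Real.exp (-s * c) *
      (collectBound r l (J.erase a) (t - s) - collectBound r l J (t - s))) :=
    continuous_finsetSum _ fun a _ => hc1 a
  have hsplit : ∫ s in (0 : ℝ)..t, c * Real.exp (-s * c) * (collectBound r l J (t - s) - κ) =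
      (∫ s in (0 : ℝ)..t, c * Real.exp (-s * c) * collectBound r l J (t - s)) -
        κ * (1 - Real.exp (-t * c)) := by
    rw [← integral_rate_mul_exp, ← intervalIntegral.integral_const_mul,
      ← intervalIntegral.integral_sub (hc2.intervalIntegrable _ _) (hc3.intervalIntegrable _ _)]
    refine intervalIntegral.integral_congr fun s _ => ?_
    ring
  rw [hsplit, ← collectBound_renewal r l c hJ t]
  simp_rw [← intervalIntegral.integral_const_mul]
  rw [mul_sub, ← intervalIntegral.integral_const_mul, ← add_sub_assoc,
    ← intervalIntegral.integral_finsetSum fun a _ => (hc1 a).intervalIntegrable _ _,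
    ← intervalIntegral.integral_add (hc5.intervalIntegrable _ _) (hc4.intervalIntegrable _ _)]
  congr 1
  · refine intervalIntegral.integral_congr fun s _ => ?_
    rw [mul_add, Finset.mul_sum, ← hr]
    congr 1
    · refine Finset.sum_congr rfl fun a _ => ?_
      rw [← hl]
      ring
    · ring
  · ring

/-- The success probability of at most `N` steps is at least the bound, up to an error that decays
geometrically in `N`. -/
theorem collectBound_sub_le {W : Set (E n)} (hW : IsCompact W) (h0 : (0 : E n) ∈ W)
    (hc : 0 < c) (hW' : IsCompact W')
    (hGm : ∀ a, MeasurableSet (G a)) (hG : Pairwise fun a b => Disjoint (G a) (G b))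
    (hGW : ∀ a, Disjoint (G a) (hitting W')) (hr : c * ν.real (hitting W') = r)
    (hl : ∀ a, c * ν.real (G a) = l a) (T : ℝ)
    {μ : Measure (ℕ × ℕ → Hyperplane n × ℝ)} [IsProbabilityMeasure μ]
    (hμr : μ.map (fun y => (y (0, 0), fun p => y (rejectIdx p))) =
      (ν.prod (expMeasure c)).prod μ)
    (hμa : μ.map (fun y => (y (0, 0), fun p => y (acceptIdx p))) =
      (ν.prod (expMeasure c)).prod μ) (N : ℕ) :
    ∀ (J : Finset (Fin q)) (C : Set (E n)) (t : ℝ), IsRandomCell W (fun _ : Unit => C) →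
      t ∈ Icc 0 T → collectBound r l J t - (1 - Real.exp (-T * c)) ^ N ≤
        μ.real {y | Collects W' G N C J t y} := by
  have := isProbabilityMeasure_expMeasure hc
  have hr0 : 0 ≤ r := hr ▸ by positivity
  have hl0 : ∀ a, 0 ≤ l a := fun a => hl a ▸ by positivity
  have hρ0 : ∀ t ∈ Icc 0 T, 0 ≤ 1 - Real.exp (-t * c) := fun t ht => by
    rw [sub_nonneg, Real.exp_le_one_iff]
    nlinarith [ht.1]
  have hempty : ∀ (N : ℕ) (C : Set (E n)) (t : ℝ), t ∈ Icc 0 T →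
      collectBound r l (∅ : Finset (Fin q)) t - (1 - Real.exp (-T * c)) ^ N ≤
        μ.real {y | Collects W' G N C (∅ : Finset (Fin q)) t y} := by
    intro N C t ht
    have : {y | Collects W' G N C (∅ : Finset (Fin q)) t y} = univ :=
      eq_univ_of_forall fun y => by cases N <;> simp [Collects]
    rw [this, probReal_univ]
    have h1 := collectBound_le_one hr0 hl0 ∅ ht.1
    have h2 := pow_nonneg (hρ0 T ⟨ht.1.trans ht.2, le_rfl⟩) N
    linarith
  induction N with
  | zero =>
    intro J C t _ ht
    have h1 := collectBound_le_one hr0 hl0 J ht.1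
    have h2 : 0 ≤ μ.real {y | Collects W' G 0 C J t y} := measureReal_nonneg
    rw [pow_zero]
    linarith
  | succ N ih =>
    intro J C t hC ht
    rcases eq_or_ne J ∅ with rfl | hJ
    · exact hempty _ _ _ ht
    set ρ := 1 - Real.exp (-T * c) with hρ
    have hρT : 0 ≤ ρ := hρ0 T ⟨ht.1.trans ht.2, le_rfl⟩
    set g := stepBound W' G r l (ρ ^ N) J t with hg
    obtain ⟨hgi, hgint⟩ := integral_stepBound (ν := ν) hc hW' hGm hG hGW hr hl (ρ ^ N) hJ ht.1
    -- the events of success after the first hyperplane divides the cell, or is rejected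
    set A : Set ((Hyperplane n × ℝ) × (ℕ × ℕ → Hyperplane n × ℝ)) :=
      {z | (z.1.2 ∈ Icc 0 t ∧ z.1.1 ∉ hitting W') ∧ z.1.1 ∈ hitting C ∧
        Collects W' G N (C ∩ z.1.1.halfSpace true) (missing G J z.1.1) (t - z.1.2) z.2} with hA
    set B : Set ((Hyperplane n × ℝ) × (ℕ × ℕ → Hyperplane n × ℝ)) :=
      {z | (z.1.2 ∈ Icc 0 t ∧ z.1.1 ∉ hitting W') ∧ z.1.1 ∉ hitting C ∧
        Collects W' G N C (missing G J z.1.1) (t - z.1.2) z.2} with hB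
    have hfirst : MeasurableSet {z : (Hyperplane n × ℝ) × (ℕ × ℕ → Hyperplane n × ℝ) |
        z.1.2 ∈ Icc 0 t ∧ z.1.1 ∉ hitting W'} :=
      (measurable_fst.snd measurableSet_Icc).inter
        (measurable_fst.fst (measurableSet_hitting hW').compl)
    have hCz : IsRandomCell W fun _ : (Hyperplane n × ℝ) × (ℕ × ℕ → Hyperplane n × ℝ) => C :=
      hC.comp (measurable_const (a := ()))
    have hhit := hCz.measurableSet_mem_hitting hW h0 measurable_fst.fst
    have hsplit : ∀ C' : (Hyperplane n × ℝ) × (ℕ × ℕ → Hyperplane n × ℝ) → Set (E n),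
        IsRandomCell W C' → MeasurableSet
          {z | Collects W' G N (C' z) (missing G J z.1.1) (t - z.1.2) z.2} := by
      intro C' hC'
      have : {z | Collects W' G N (C' z) (missing G J z.1.1) (t - z.1.2) z.2} =
          ⋃ K : Finset (Fin q), {z | missing G J z.1.1 = K} ∩
            {z | Collects W' G N (C' z) K (t - z.1.2) z.2} := by
        ext z; simp
      rw [this]
      exact MeasurableSet.iUnion fun K =>
        (measurable_fst.fst (measurableSet_missing_eq hGm J K)).inter
          (measurableSet_collects hW hW' h0 hGm N K C' _ _ hC'
            (measurable_const.sub measurable_fst.snd) measurable_snd)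
    have hAm : MeasurableSet A :=
      hfirst.inter (hhit.inter (hsplit _ (hCz.inter_halfSpace measurable_fst.fst)))
    have hBm : MeasurableSet B := hfirst.inter (hhit.compl.inter (hsplit _ hCz))
    have hE : {y | Collects W' G (N + 1) C J t y} =
        (fun y => (y (0, 0), fun p => y (acceptIdx p))) ⁻¹' A ∪
        (fun y => (y (0, 0), fun p => y (rejectIdx p))) ⁻¹' B := by
      ext y
      simp only [Collects, hJ, false_or, hA, hB, mem_union, mem_preimage, mem_ofPred_eq]
      tauto
    have hma : Measurable fun y : ℕ × ℕ → Hyperplane n × ℝ =>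
        (y (0, 0), fun p => y (acceptIdx p)) := by fun_prop
    have hmr : Measurable fun y : ℕ × ℕ → Hyperplane n × ℝ =>
        (y (0, 0), fun p => y (rejectIdx p)) := by fun_prop
    have hdisj : Disjoint ((fun y : ℕ × ℕ → Hyperplane n × ℝ =>
          (y (0, 0), fun p => y (acceptIdx p))) ⁻¹' A)
        ((fun y => (y (0, 0), fun p => y (rejectIdx p))) ⁻¹' B) := by
      rw [disjoint_left]
      intro y hy1 hy2
      exact hy2.2.1 hy1.2.1
    have hμE : μ {y | Collects W' G (N + 1) C J t y} =
        ∫⁻ a, (μ (Prod.mk a ⁻¹' A) + μ (Prod.mk a ⁻¹' B)) ∂(ν.prod (expMeasure c)) := by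
      rw [hE, measure_union hdisj (hmr hBm), ← Measure.map_apply hma hAm,
        ← Measure.map_apply hmr hBm, hμa, hμr, Measure.prod_apply hAm, Measure.prod_apply hBm,
        lintegral_add_left (measurable_measure_prodMk_left hAm)]
    have hle : ∫⁻ a, ENNReal.ofReal (g a) ∂(ν.prod (expMeasure c)) ≤
        μ {y | Collects W' G (N + 1) C J t y} := by
      rw [hμE]
      refine lintegral_mono fun a => ?_
      obtain ⟨D, s⟩ := a
      simp only [hg, stepBound]
      by_cases hs : s ∈ Icc 0 t
      swap
      · simp [indicator_of_notMem hs]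
      by_cases hD : D ∈ (hitting W')ᶜ
      swap
      · simp [indicator_of_mem hs, indicator_of_notMem hD]
      rw [indicator_of_mem hs, indicator_of_mem hD]
      have hts : t - s ∈ Icc 0 T := ⟨by linarith [hs.2], by linarith [hs.1, ht.2]⟩
      by_cases hDC : D ∈ hitting C
      · refine le_add_of_le_left (ENNReal.ofReal_le_of_le_toReal ?_)
        have h1 : Prod.mk (D, s) ⁻¹' A = {y | Collects W' G N (C ∩ D.halfSpace true)
            (missing G J D) (t - s) y} := by
          ext y
          exact ⟨fun h => h.2.2, fun h => ⟨⟨hs, hD⟩, hDC, h⟩⟩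
        rw [h1]
        exact ih _ _ _ (hC.inter_halfSpace measurable_const) hts
      · refine le_add_of_le_right (ENNReal.ofReal_le_of_le_toReal ?_)
        have h1 : Prod.mk (D, s) ⁻¹' B = {y | Collects W' G N C
            (missing G J D) (t - s) y} := by
          ext y
          exact ⟨fun h => h.2.2, fun h => ⟨⟨hs, hD⟩, hDC, h⟩⟩
        rw [h1]
        exact ih _ _ _ hC hts
    have h1 : ∫ a, g a ∂(ν.prod (expMeasure c)) ≤
        μ.real {y | Collects W' G (N + 1) C J t y} := by
      rw [integral_eq_lintegral_pos_part_sub_lintegral_neg_part hgi]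
      have := ENNReal.toReal_mono (measure_ne_top μ _) hle
      rw [measureReal_def]
      linarith [ENNReal.toReal_nonneg (a := ∫⁻ a, ENNReal.ofReal (-g a) ∂(ν.prod (expMeasure c)))]
    refine le_trans ?_ h1
    rw [hg, hgint]
    have h2 : 1 - ν.real (hitting W') ≤ 1 := sub_le_self _ measureReal_nonneg
    have h3 : 1 - Real.exp (-t * c) ≤ ρ := by
      rw [hρ]
      have : Real.exp (-T * c) ≤ Real.exp (-t * c) := Real.exp_le_exp.2 (by nlinarith [ht.2])
      linarith
    have h4 : 0 ≤ ρ ^ N := pow_nonneg hρT N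
    have h5 : (1 - ν.real (hitting W')) * ρ ^ N ≤ ρ ^ N := mul_le_of_le_one_left h4 h2
    have h6 : (1 - ν.real (hitting W')) * ρ ^ N * (1 - Real.exp (-t * c)) ≤ ρ ^ N * ρ :=
      mul_le_mul h5 h3 (hρ0 t ht) h4
    rw [pow_succ]
    linarith

end Integral

/-! ### The cell of the origin -/

/-- The input that is still unread when the zero cell has been divided `j` times and `m` hyperplanes
have been rejected since then. -/
def unread (h : List Bool → ℕ → Hyperplane n) (s : List Bool → ℕ → ℝ) (j m : ℕ) (p : ℕ × ℕ) :
    Hyperplane n × ℝ :=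
  (h (List.replicate (j + p.1) true) ((if p.1 = 0 then m else 0) + p.2),
    s (List.replicate (j + p.1) true) ((if p.1 = 0 then m else 0) + p.2))

lemma unread_rejectIdx (h : List Bool → ℕ → Hyperplane n) (s : List Bool → ℕ → ℝ) (j m : ℕ) :
    (fun p => unread h s j m (rejectIdx p)) = unread h s j (m + 1) := by
  funext ⟨i, k⟩
  rcases i with _ | i
  · simp [unread, rejectIdx, add_assoc]
  · simp [unread, rejectIdx]

lemma unread_acceptIdx (h : List Bool → ℕ → Hyperplane n) (s : List Bool → ℕ → ℝ) (j m : ℕ) :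
    (fun p => unread h s j m (acceptIdx p)) = unread h s (j + 1) 0 := by
  funext ⟨i, k⟩
  have : j + (i + 1) = j + 1 + i := by omega
  simp [unread, acceptIdx, this]

lemma convex_halfSpace_true (H : Hyperplane n) : Convex ℝ (H.halfSpace true) := by
  rw [H.halfSpace_true]
  exact convex_halfSpace_le (innerSL ℝ H.foot).isLinear _

lemma IsWindow.convex {W : Set (E n)} (hW : IsWindow W) : Convex ℝ W := by
  obtain ⟨s, hs⟩ := hW.polyhedral
  have : W = ⋂ p ∈ s, {x | inner ℝ p.1 x ≤ p.2} := by
    rw [hs]; ext; simp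
  rw [this]
  exact convex_iInter₂ fun p _ => convex_halfSpace_le (innerSL ℝ p.1).isLinear _

/-- The zero cell `C` has been divided `j` times, and `m` hyperplanes have been rejected since then,
all without hitting `W'`; this has taken the time `e`, and `C` has been separated from all sets
`f a` with `a ∉ J`. -/
structure IsZeroCell {q : ℕ} (W W' : Set (E n)) (f : Fin q → Set (E n))
    (h : List Bool → ℕ → Hyperplane n) (s : List Bool → ℕ → ℝ) (J : Finset (Fin q)) (j m : ℕ)
    (C : Set (E n)) (e : ℝ) : Prop where
  eq_cell : C = cell W h (List.replicate j true)
  subset : C ⊆ W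
  convex : Convex ℝ C
  core_subset : W' ⊆ C
  zero_mem : (0 : E n) ∈ interior C
  disjoint : ∀ a ∉ J, Disjoint C (f a)
  le_firstHit : m ≤ firstHit C (h (List.replicate j true))
  elapsed_eq : e = birth W h s (List.replicate j true) +
    ∑ i ∈ Finset.range m, s (List.replicate j true) i
  elapsed_nonneg : 0 ≤ e
  elapsed_pos : J = ∅ → 0 < e

section Pathwise

variable {W W' : Set (E n)} {q : ℕ} {f : Fin q → Set (E n)} {G : Fin q → Set (Hyperplane n)}
  {h : List Bool → ℕ → Hyperplane n} {s : List Bool → ℕ → ℝ} {J : Finset (Fin q)} {j m : ℕ}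
  {C : Set (E n)} {e : ℝ}

lemma IsZeroCell.encapsulatedAt (hC : IsZeroCell W W' f h s ∅ j m C e) (hW : IsWindow W)
    (hf : range f = facets W) (hs : ∀ m, 0 < s (List.replicate j true) m) :
    EncapsulatedAt W h s W' e := by
  refine ⟨C, ⟨List.replicate j true, hC.eq_cell, ?_, ?_⟩, hC.zero_mem, hC.core_subset, ?_⟩
  · rw [hC.elapsed_eq]
    exact le_add_of_nonneg_right (Finset.sum_nonneg fun i _ => (hs i).le)
  · rw [hC.elapsed_eq, lifetime, ← hC.eq_cell]
    refine add_lt_add_right ?_ _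
    refine lt_of_lt_of_le ?_ (Finset.sum_le_sum_of_subset_of_nonneg
      (Finset.range_subset_range.2 (Nat.succ_le_succ hC.le_firstHit)) fun i _ _ => (hs i).le)
    rw [Finset.sum_range_succ]
    exact lt_add_of_pos_right _ (hs m)
  · refine subset_interior_of_disjoint_facets hW hC.subset fun F hF => ?_
    rw [← hf] at hF
    obtain ⟨a, rfl⟩ := hF
    exact hC.disjoint a (Finset.notMem_empty a)

/-- The next hyperplane hits the zero cell and divides it. -/
lemma IsZeroCell.accept (hC : IsZeroCell W W' f h s J j m C e) (hW' : Convex ℝ W')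
    (h0 : (0 : E n) ∈ W') (hG : ∀ a, G a ⊆ separating W' (f a))
    (hs : 0 < s (List.replicate j true) m)
    (hDW' : h (List.replicate j true) m ∉ hitting W')
    (hDC : h (List.replicate j true) m ∈ hitting C) :
    IsZeroCell W W' f h s (missing G J (h (List.replicate j true) m)) (j + 1) 0
      (C ∩ (h (List.replicate j true) m).halfSpace true) (e + s (List.replicate j true) m) := by
  have hfirst : firstHit C (h (List.replicate j true)) = m :=
    le_antisymm (Nat.sInf_le hDC) hC.le_firstHit
  have hlt : ∀ x ∈ W', inner ℝ (h (List.replicate j true) m).foot x <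
      ‖(h (List.replicate j true) m).foot‖ ^ 2 := fun x hx =>
    inner_foot_lt_of_notMem_hitting h0 (hW'.starConvex h0) hDW' hx
  have hpos := add_pos_of_nonneg_of_pos hC.elapsed_nonneg hs
  refine ⟨?_, inter_subset_left.trans hC.subset, hC.convex.inter (convex_halfSpace_true _), ?_, ?_,
    ?_, Nat.zero_le _, ?_, hpos.le, fun _ => hpos⟩
  · rw [List.replicate_succ, cell, ← hC.eq_cell, hfirst]
  · refine subset_inter hC.core_subset fun x hx => ?_
    rw [Hyperplane.halfSpace_true]
    exact (hlt x hx).le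
  · rw [interior_inter]
    refine ⟨hC.zero_mem, mem_interior.2 ⟨{x | inner ℝ (h (List.replicate j true) m).foot x <
      ‖(h (List.replicate j true) m).foot‖ ^ 2}, ?_, isOpen_lt (by fun_prop) (by fun_prop),
      hlt 0 h0⟩⟩
    rw [Hyperplane.halfSpace_true]
    intro x hx
    rw [mem_ofPred_eq] at hx ⊢
    exact hx.le
  · intro a ha
    rw [mem_missing, not_and_not_right] at ha
    by_cases haJ : a ∈ J
    · rw [Hyperplane.halfSpace_true, disjoint_left]
      intro x hx hxf
      exact ((inner_foot_of_mem_separating h0 (hG a (ha haJ))).2 x hxf).not_ge hx.2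
    · exact (hC.disjoint a haJ).mono_left inter_subset_left
  · rw [List.replicate_succ, birth, lifetime, ← hC.eq_cell, hfirst, Finset.sum_range_succ,
      hC.elapsed_eq]
    simp [add_assoc]

/-- The next hyperplane misses the zero cell and is rejected. -/
lemma IsZeroCell.reject (hC : IsZeroCell W W' f h s J j m C e)
    (h0 : (0 : E n) ∈ W') (hG : ∀ a, G a ⊆ separating W' (f a))
    (hs : 0 < s (List.replicate j true) m)
    (hh : ∃ m, h (List.replicate j true) m ∈ hitting W')
    (hDC : h (List.replicate j true) m ∉ hitting C) :
    IsZeroCell W W' f h s (missing G J (h (List.replicate j true) m)) j (m + 1)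
      C (e + s (List.replicate j true) m) := by
  have hpos := add_pos_of_nonneg_of_pos hC.elapsed_nonneg hs
  refine ⟨hC.eq_cell, hC.subset, hC.convex, hC.core_subset, hC.zero_mem, ?_, ?_, ?_, hpos.le,
    fun _ => hpos⟩
  · intro a ha
    rw [mem_missing, not_and_not_right] at ha
    by_cases haJ : a ∈ J
    · rw [disjoint_left]
      intro x hx hxf
      have h0C := hC.core_subset h0
      exact ((inner_foot_of_mem_separating h0 (hG a (ha haJ))).2 x hxf).not_gt
        (inner_foot_lt_of_notMem_hitting h0C (hC.convex.starConvex h0C) hDC hx)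
    · exact hC.disjoint a haJ
  · -- some hyperplane of the current sequence hits the cell, so `firstHit` is not a junk value
    have hne : {m | h (List.replicate j true) m ∈ hitting C}.Nonempty := by
      obtain ⟨k, x, hx, hxW'⟩ := hh
      exact ⟨k, x, hx, hC.core_subset hxW'⟩
    refine Nat.succ_le_of_lt (lt_of_le_of_ne hC.le_firstHit fun hm => hDC ?_)
    rw [hm]
    exact Nat.sInf_mem hne
  · rw [Finset.sum_range_succ, hC.elapsed_eq, add_assoc]

/-- If the hyperplanes for all facets have been collected, then `W'` is encapsulated.  A hyperplane
that separates `W'` from a facet separates the zero cell from this facet, whether it divides the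
cell or is rejected. -/
lemma exists_encapsulatedAt (hW : IsWindow W) (hW' : Convex ℝ W') (h0 : (0 : E n) ∈ W')
    (hf : range f = facets W) (hG : ∀ a, G a ⊆ separating W' (f a))
    (hs : ∀ j m, 0 < s (List.replicate j true) m)
    (hh : ∀ j, ∃ m, h (List.replicate j true) m ∈ hitting W') (N : ℕ) :
    ∀ (J : Finset (Fin q)) (j m : ℕ) (C : Set (E n)) (e t : ℝ),
      IsZeroCell W W' f h s J j m C e → 0 ≤ t → Collects W' G N C J t (unread h s j m) →
      ∃ r, 0 < r ∧ r ≤ e + t ∧ EncapsulatedAt W h s W' r := by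
  induction N with
  | zero =>
    rintro _ j m C e t hC ht rfl
    exact ⟨e, hC.elapsed_pos rfl, by linarith, hC.encapsulatedAt hW hf (hs j)⟩
  | succ N ih =>
    rintro J j m C e t hC ht (rfl | ⟨⟨hτ, hDW'⟩, hstep⟩)
    · exact ⟨e, hC.elapsed_pos rfl, by linarith, hC.encapsulatedAt hW hf (hs j)⟩
    rw [unread_acceptIdx, unread_rejectIdx] at hstep
    have hy : unread h s j m (0, 0) =
        (h (List.replicate j true) m, s (List.replicate j true) m) := by simp [unread]
    rw [hy] at hτ hDW' hstep
    have ht' : 0 ≤ t - s (List.replicate j true) m := sub_nonneg.2 hτ.2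
    rcases hstep with ⟨hDC, hcol⟩ | ⟨hDC, hcol⟩
    · obtain ⟨r, hr0, hrt, hr⟩ := ih _ _ _ _ _ _ (hC.accept hW' h0 hG (hs j m) hDW' hDC) ht' hcol
      exact ⟨r, hr0, by linarith, hr⟩
    · obtain ⟨r, hr0, hrt, hr⟩ := ih _ _ _ _ _ _ (hC.reject h0 hG (hs j m) (hh j) hDC) ht' hcol
      exact ⟨r, hr0, by linarith, hr⟩

end Pathwise

/-! ### The random input -/

/-- A window is hit with positive measure: countably many translates of it cover the space. -/
lemma measure_hitting_pos {Λ : Measure (Hyperplane n)} (hΛ : IsDirecting Λ) {W : Set (E n)}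
    (hW : IsWindow W) : 0 < Λ (hitting W) := by
  rw [pos_iff_ne_zero]
  intro h0
  apply hΛ.ne_zero
  rw [← Measure.measure_univ_eq_zero]
  have hcov : (univ : Set (Hyperplane n)) ⊆
      ⋃ k : ℕ, Hyperplane.translate (-TopologicalSpace.denseSeq (E n) k) ⁻¹' hitting W := by
    intro H _
    obtain ⟨x, hx⟩ := H.2.1
    obtain ⟨w, hw⟩ := hW.interior_nonempty
    have hopen : IsOpen {v : E n | -v + x ∈ interior W} :=
      isOpen_interior.preimage (by fun_prop)
    obtain ⟨k, hk⟩ := (TopologicalSpace.denseRange_denseSeq (E n)).exists_mem_open hopen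
      ⟨x - w, by simpa using hw⟩
    refine mem_iUnion.2 ⟨k, -TopologicalSpace.denseSeq (E n) k + x, ?_, interior_subset hk⟩
    exact (AffineSubspace.mem_map).2 ⟨x, hx, rfl⟩
  refine measure_mono_null hcov (measure_iUnion_null fun k => ?_)
  rw [(hΛ.translation_invariant _).measure_preimage
    (measurableSet_hitting hW.isCompact).nullMeasurableSet, h0]

section Input

variable {Λ : Measure (Hyperplane n)} {W : Set (E n)} {Ω : Type*} [MeasurableSpace Ω]
  {P : Measure Ω} {d : List Bool → ℕ → Ω → Hyperplane n}
  {τ : List Bool → ℕ → Ω → ℝ}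

lemma IsInput.isProbabilityMeasure_normalized [IsProbabilityMeasure P] (hi : IsInput Λ W P d τ) :
    IsProbabilityMeasure (normalized Λ W) := by
  rw [← hi.law_d [] 0]
  exact Measure.isProbabilityMeasure_map (hi.measurable_d _ _).aemeasurable

/-- The input read by the zero cell is a family of independent pairs of a hyperplane and a waiting
time. -/
lemma IsInput.map_unread [IsProbabilityMeasure P] (hi : IsInput Λ W P d τ) :
    P.map (fun ω => unread (fun u m => d u m ω) (fun u m => τ u m ω) 0 0) =
      Measure.infinitePi fun _ : ℕ × ℕ =>
        (normalized Λ W).prod (expMeasure (Λ.real (hitting W))) := by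
  have hind := iIndepFun_prodMk (fun i : List Bool × ℕ => hi.measurable_d i.1 i.2)
    (fun i => hi.measurable_τ i.1 i.2) hi.indep_d hi.indep_τ hi.indep_d_τ
  have hinj : Function.Injective fun p : ℕ × ℕ => (List.replicate p.1 true, p.2) := by
    rintro ⟨i, k⟩ ⟨j, m⟩ h
    simp only [Prod.mk.injEq] at h
    have h1 := congrArg List.length h.1
    simp only [List.length_replicate] at h1
    exact Prod.ext h1 h.2
  have h2 := (hind.precomp hinj).map_fun_eq_infinitePi_map fun p =>
    (hi.measurable_d _ _).prodMk (hi.measurable_τ _ _)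
  have h3 : (fun ω => unread (fun u m => d u m ω) (fun u m => τ u m ω) 0 0) =
      fun ω (p : ℕ × ℕ) => (d (List.replicate p.1 true) p.2 ω,
        τ (List.replicate p.1 true) p.2 ω) := by
    funext ω p
    simp [unread]
  rw [h3]
  refine h2.trans ?_
  congr 1
  funext p
  have h4 : IndepFun (d (List.replicate p.1 true) p.2) (τ (List.replicate p.1 true) p.2) P :=
    hi.indep_d_τ.comp (measurable_pi_apply (List.replicate p.1 true, p.2))
      (measurable_pi_apply (List.replicate p.1 true, p.2))
  have h5 := h4.map_prod_eq_prod_map_map (hi.measurable_d _ _).aemeasurable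
    (hi.measurable_τ _ _).aemeasurable
  rw [hi.law_d, hi.law_τ] at h5
  exact h5

lemma IsInput.ae_pos (hi : IsInput Λ W P d τ) (hc : 0 < Λ.real (hitting W)) :
    ∀ᵐ ω ∂P, ∀ u m, 0 < τ u m ω := by
  refine ae_all_iff.2 fun u => ae_all_iff.2 fun m => ?_
  have h := expMeasure_Iic_zero hc
  rw [← hi.law_τ u m, Measure.map_apply (hi.measurable_τ u m) measurableSet_Iic] at h
  rw [ae_iff]
  simpa [preimage, not_lt] using h

/-- Almost surely every sequence of hyperplanes hits any given set that is hit with positive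
probability. -/
lemma IsInput.ae_exists_mem [IsProbabilityMeasure P] (hi : IsInput Λ W P d τ) {A : Set (Hyperplane n)}
    (hA : MeasurableSet A) (hpos : 0 < normalized Λ W A) :
    ∀ᵐ ω ∂P, ∀ u, ∃ m, d u m ω ∈ A := by
  have := hi.isProbabilityMeasure_normalized
  refine ae_all_iff.2 fun u => ?_
  have hinj : Function.Injective fun m : ℕ => (u, m) := fun _ _ h => (Prod.mk.inj h).2
  have hind := hi.indep_d.precomp hinj
  have hle : ∀ N : ℕ, P {ω | ¬ ∃ m, d u m ω ∈ A} ≤ (normalized Λ W Aᶜ) ^ N := by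
    intro N
    have h1 := hind.measure_inter_preimage_eq_mul (Finset.range N) (sets := fun _ => Aᶜ)
      fun _ _ => hA.compl
    have h2 : ∀ m, P ((d u m) ⁻¹' Aᶜ) = normalized Λ W Aᶜ := fun m => by
      rw [← hi.law_d u m, Measure.map_apply (hi.measurable_d u m) hA.compl]
    calc P {ω | ¬ ∃ m, d u m ω ∈ A} ≤ P (⋂ m ∈ Finset.range N, (d u m) ⁻¹' Aᶜ) := by
          refine measure_mono fun ω hω => mem_iInter₂.2 fun m _ hm => hω ⟨m, hm⟩
      _ = ∏ _m ∈ Finset.range N, normalized Λ W Aᶜ := by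
          refine h1.trans (Finset.prod_congr rfl fun m _ => h2 m)
      _ = _ := by rw [Finset.prod_const, Finset.card_range]
  have hlt : normalized Λ W Aᶜ < 1 := by
    rw [prob_compl_eq_one_sub hA]
    exact ENNReal.sub_lt_self ENNReal.one_ne_top one_ne_zero hpos.ne'
  rw [ae_iff]
  exact le_antisymm (ge_of_tendsto' (ENNReal.tendsto_pow_atTop_nhds_zero_of_lt_one hlt) hle)
    (zero_le)

end Input

end STIT

end

theorem mainTheorem3 {n : ℕ} (hn : 1 ≤ n)
    (Λ : Measure (STIT.Hyperplane n)) (hΛ : STIT.IsDirecting Λ)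
    (W' W : Set (STIT.E n)) (hW' : STIT.IsWindow W') (hW : STIT.IsWindow W)
    (h0 : (0 : STIT.E n) ∈ W') (hsub : W' ⊆ interior W)
    (q : ℕ) (f : Fin q → Set (STIT.E n)) (hf_inj : Function.Injective f)
    (hf : Set.range f = STIT.facets W)
    (G' : Fin q → Set (STIT.Hyperplane n))
    (hG_meas : ∀ a, MeasurableSet (G' a))
    (hG_disj : Pairwise fun a b => Disjoint (G' a) (G' b))
    (hG_sub : ∀ a, G' a ⊆ STIT.separating W' (f a))
    (hG_pos : ∀ a, 0 < Λ (G' a))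
    {Ω : Type*} [MeasurableSpace Ω] (P : Measure Ω) [IsProbabilityMeasure P]
    (d : List Bool → ℕ → Ω → STIT.Hyperplane n) (τ : List Bool → ℕ → Ω → ℝ)
    (hinput : STIT.IsInput Λ W P d τ)
    (t : ℝ) (ht : 0 ≤ t) :
    Real.exp (-t * Λ.real (STIT.hitting W')) *
          ∏ a, (1 - Real.exp (-t * Λ.real (G' a))) +
        ∫ x in (0 : ℝ)..t, Λ.real (STIT.hitting W') * Real.exp (-x * Λ.real (STIT.hitting W')) *
          ∏ a, (1 - Real.exp (-x * Λ.real (G' a)))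
      ≤ P.real {ω | STIT.encapsulationTime W (fun u m => d u m ω) (fun u m => τ u m ω) W'
          ≤ (t : EReal)} := by
  open STIT in
  have hW'W : W' ⊆ W := hsub.trans interior_subset
  have hfinW : Λ (hitting W) ≠ ⊤ := (hΛ.locally_finite W hW.isCompact.isBounded).ne
  have hposW := measure_hitting_pos hΛ hW
  set c := Λ.real (hitting W) with hc_def
  have hc : 0 < c := ENNReal.toReal_pos hposW.ne' hfinW
  have := hinput.isProbabilityMeasure_normalized
  have := isProbabilityMeasure_expMeasure hc
  have hnorm : ∀ A, MeasurableSet A → A ⊆ hitting W →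
      normalized Λ W A = (Λ (hitting W))⁻¹ * Λ A := fun A hA hAW => by
    rw [normalized, Measure.smul_apply, Measure.restrict_apply hA, inter_eq_left.2 hAW,
      smul_eq_mul]
  have hrate : ∀ A, MeasurableSet A → A ⊆ hitting W →
      c * (normalized Λ W).real A = Λ.real A := fun A hA hAW => by
    rw [measureReal_def, hnorm A hA hAW, ENNReal.toReal_mul, ENNReal.toReal_inv, ← measureReal_def,
      ← measureReal_def, mul_inv_cancel_left₀ hc.ne']
  have hW'm := measurableSet_hitting hW'.isCompact
  have hW'hit : hitting W' ⊆ hitting W := fun H ⟨x, hx, hxW'⟩ => ⟨x, hx, hW'W hxW'⟩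
  have hGW : ∀ a, Disjoint (G' a) (hitting W') := fun a => by
    rw [disjoint_left]
    intro H hH hHW'
    obtain ⟨x, hx, hxf⟩ := (mem_hitting_iff_foot h0 H).1 hHW'
    exact ((inner_foot_of_mem_separating h0 (hG_sub a hH)).1 x hx).ne hxf
  have hGhit : ∀ a, G' a ⊆ hitting W := fun a H hH => by
    by_contra hHW
    have hfa : f a ∈ facets W := hf ▸ mem_range_self a
    obtain ⟨x, hx⟩ := hfa.2.1
    have h0W := hW'W h0
    exact ((inner_foot_of_mem_separating h0 (hG_sub a hH)).2 x hx).not_gt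
      (inner_foot_lt_of_notMem_hitting h0W (hW.convex.starConvex h0W) hHW (hfa.1.subset hx))
  set μ := Measure.infinitePi fun _ : ℕ × ℕ => (normalized Λ W).prod (expMeasure c) with hμ
  set X : Ω → ℕ × ℕ → Hyperplane n × ℝ :=
    fun ω => unread (fun u m => d u m ω) (fun u m => τ u m ω) 0 0 with hX
  have hXm : Measurable X := measurable_pi_lambda _ fun p =>
    (hinput.measurable_d _ _).prodMk (hinput.measurable_τ _ _)
  have hmap : P.map X = μ := hinput.map_unread
  -- there is at least one facet, so that the zero cell `W` at time `0` does not count as a success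
  have huniv : (Finset.univ : Finset (Fin q)) ≠ ∅ := by
    obtain ⟨F, hF⟩ := facets_nonempty hn hW
    rw [← hf] at hF
    obtain ⟨a, -⟩ := hF
    exact Finset.ne_empty_of_mem (Finset.mem_univ a)
  have hgood := (hinput.ae_pos hc).and (hinput.ae_exists_mem hW'm (by
    rw [hnorm _ hW'm hW'hit]
    exact ENNReal.mul_pos (ENNReal.inv_ne_zero.2 hfinW) (measure_hitting_pos hΛ hW').ne'))
  have hsucc : ∀ N, μ.real {y | Collects W' G' N W Finset.univ t y} ≤
      P.real {ω | encapsulationTime W (fun u m => d u m ω) (fun u m => τ u m ω) W'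
          ≤ (t : EReal)} := by
    intro N
    have hm : MeasurableSet {y | Collects W' G' N W Finset.univ t y} :=
      measurableSet_collects hW.isCompact hW'.isCompact (hW'W h0) hG_meas N Finset.univ
        (fun _ => W) (fun _ => t) id (IsRandomCell.const W) measurable_const measurable_id
    rw [← hmap, map_measureReal_apply hXm hm, measureReal_def, measureReal_def]
    refine ENNReal.toReal_mono (measure_ne_top _ _) (measure_mono_ae ?_)
    filter_upwards [hgood] with ω hω hcol
    obtain ⟨r, hr0, hrt, hr⟩ := exists_encapsulatedAt hW hW'.convex h0 hf hG_sub
      (fun j m => hω.1 _ m) (fun j => hω.2 _) N Finset.univ 0 0 W 0 t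
      ⟨rfl, Subset.rfl, hW.convex, hW'W, hsub h0, by simp, Nat.zero_le _, by simp [birth],
        le_rfl, fun h => absurd h huniv⟩ ht hcol
    rw [zero_add] at hrt
    have hle : encapsulationTime W (fun u m => d u m ω) (fun u m => τ u m ω) W' ≤ (r : EReal) :=
      sInf_le (mem_image_of_mem _ ⟨hr0, hr⟩)
    exact hle.trans (EReal.coe_le_coe_iff.2 hrt)
  have hbound : ∀ N : ℕ, collectBound (Λ.real (hitting W')) (fun a => Λ.real (G' a)) Finset.univ t -
      (1 - Real.exp (-t * c)) ^ N ≤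
      P.real {ω | encapsulationTime W (fun u m => d u m ω) (fun u m => τ u m ω) W'
          ≤ (t : EReal)} := fun N =>
    (collectBound_sub_le hW.isCompact (hW'W h0) hc hW'.isCompact hG_meas hG_disj hGW
      (hrate _ hW'm hW'hit) (fun a => hrate _ (hG_meas a) (hGhit a)) t
      (map_eval_prodMk_comp_infinitePi _ _ rejectIdx_injective rejectIdx_ne_zero)
      (map_eval_prodMk_comp_infinitePi _ _ acceptIdx_injective acceptIdx_ne_zero) N Finset.univ W t
      (IsRandomCell.const W) ⟨ht, le_rfl⟩).trans (hsucc N)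
  have hlim : Filter.Tendsto (fun N : ℕ => collectBound (Λ.real (hitting W'))
      (fun a => Λ.real (G' a)) Finset.univ t - (1 - Real.exp (-t * c)) ^ N) Filter.atTop
      (nhds (collectBound (Λ.real (hitting W')) (fun a => Λ.real (G' a)) Finset.univ t - 0)) := by
    refine tendsto_const_nhds.sub (tendsto_pow_atTop_nhds_zero_of_lt_one ?_ ?_)
    · rw [sub_nonneg, Real.exp_le_one_iff, neg_mul, neg_nonpos]
      exact mul_nonneg ht hc.le
    · exact sub_lt_self _ (Real.exp_pos _)
  rw [sub_zero] at hlim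
  exact le_of_tendsto' hlim hbound
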